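/- Throughout, $q$ is a complex number with $|q|<1$. Let $$E_2(q)=1-24\sum_{n\ge1}\sigma_1(n)q^n,\qquad \theta_2(q)=\sum_{m\in\mathbb Z+\frac12}q^{m^2},\qquad \theta_3(q)=\sum_{m\in\mathbb Z}q^{m^2},$$ where $\sigma_1(n)=\sum_{d\mid n}d$ and $q^{1/4}$ in $\theta_2$ is the principal branch (only powers of $\theta_2^4$ are used, and these do not depend on the branch). For integers $r,s\ge0$ put $$\Theta_{r,s}(q)=\theta_2^{4r}(q)\,\theta_3^{4s}(q)+\theta_2^{4s}(q)\,\theta_3^{4r}(q)$$ (so $\Theta_{0,0}=2$). Let $c_c(\alpha,\beta,\gamma)$, for integers $\alpha,\beta,\gamma$, be the rational numbers determined by $c_c(\alpha,\beta,\gamma)=0$ if any argument is negative, $c_c(0,0,0)=1$, and, for all other $\alpha,\beta,\gamma\ge0$, $$\begin{aligned}c_c(\alpha,\beta,\gamma)&=\tfrac{2\alpha+4\beta+4\gamma-1}{24}\,c_c(\alpha-1,\beta,\gamma)+\tfrac{20\gamma-4\beta+3}{24}\,c_c(\alpha,\beta-1,\gamma)+\tfrac{20\beta-4\gamma+3}{24}\,c_c(\alpha,\beta,\gamma-1)\\&\quad-\tfrac{7(\alpha+1)}{6}\,c_c(\alpha+1,\beta-1,\gamma-1)-\tfrac{\alpha+1}{12}\,c_c(\alpha+1,\beta-2,\gamma)-\tfrac{\alpha+1}{12}\,c_c(\alpha+1,\beta,\gamma-2).\end{aligned}$$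 Let $\mathbf e_0=1$ and let $\mathbf e_j(x_1,\dots,x_r)=\sum_{1\le i_1<\cdots<i_j\le r}x_{i_1}\cdots x_{i_j}$ be the elementary symmetric functions. **Theorem.** Let $t$ be a positive integer. Then MacMahon's series $$\mathcal C_{2t}(q)=\sum_{0<s_1<s_2<\cdots<s_t}\frac{q^{2s_1+2s_2+\cdots+2s_t-t}}{(1-q^{2s_1-1})^2(1-q^{2s_2-1})^2\cdots(1-q^{2s_t-1})^2}$$ (sum over integers $s_i$) converges absolutely for $|q|<1$, and $$\mathcal C_{2t}(q)=\sum_{k=1}^t(-1)^k\,\frac{\mathbf e_{t-k}(0^2,1^2,\dots,(t-1)^2)}{(2t)!}\cdot\frac12\sum_{\substack{\alpha,\beta,\gamma\ge0\\ \alpha+\beta+\gamma=k}}c_c(\alpha,\beta,\gamma)\,E_2(q)^{\alpha}\,\Theta_{\beta,\gamma}(q).$$ -/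

import Mathlib

namespace MacMahonC

noncomputable section

/-- The summand of MacMahon's odd-part series attached to `s 0 < s 1 < ⋯ < s (t-1)`
(positive integers): the product of `q^(2 s_i - 1) / (1 - q^(2 s_i - 1))^2`.
The numerators multiply to `q^(2 s_0 + ⋯ + 2 s_(t-1) - t)`. -/
def term (t : ℕ) (q : ℂ) (s : Fin t ↪o ℕ+) : ℂ :=
  ∏ i, q ^ (2 * (s i : ℕ) - 1) / (1 - q ^ (2 * (s i : ℕ) - 1)) ^ 2

/-- MacMahon's series `𝒞_{2t}(q)`, the sum over all `0 < s₁ < ⋯ < s_t`. -/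
def C (t : ℕ) (q : ℂ) : ℂ := ∑' s : Fin t ↪o ℕ+, term t q s

/-- The Eisenstein series `E_{2k}(q) = 1 - (4k / B_{2k}) ∑_{n ≥ 1} σ_{2k-1}(n) q^n`. -/
def eisenstein (k : ℕ) (q : ℂ) : ℂ :=
  1 - (4 * k / (bernoulli (2 * k) : ℂ)) *
    ∑' n : ℕ+, (ArithmeticFunction.sigma (2 * k - 1) (n : ℕ) : ℂ) * q ^ (n : ℕ)

/-- `θ₂(q) = ∑_{m ∈ ℤ + 1/2} q^(m²)`, with the principal branch of `q^(1/4)`.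
Only powers of `θ₂⁴` occur below, and those do not depend on the branch. -/
def theta2 (q : ℂ) : ℂ := ∑' m : ℤ, q ^ (((m : ℂ) + 1 / 2) ^ 2)

/-- `θ₃(q) = ∑_{m ∈ ℤ} q^(m²)`. -/
def theta3 (q : ℂ) : ℂ := ∑' m : ℤ, q ^ (m ^ 2 : ℤ)

/-- `Θ_{r,s}(q) = θ₂^(4r) θ₃^(4s) + θ₂^(4s) θ₃^(4r)`; in particular `Θ_{0,0} = 2`. -/
def Theta (r s : ℕ) (q : ℂ) : ℂ :=
  theta2 q ^ (4 * r) * theta3 q ^ (4 * s) + theta2 q ^ (4 * s) * theta3 q ^ (4 * r)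

/-- The recursively defined coefficients `c_c(α, β, γ)`: zero if an argument is negative,
`c_c(0, 0, 0) = 1`, and given by the recursion at every other triple of nonnegative integers. -/
def cc (α β γ : ℤ) : ℚ :=
  if α < 0 ∨ β < 0 ∨ γ < 0 then 0
  else if α = 0 ∧ β = 0 ∧ γ = 0 then 1
  else
    (2 * α + 4 * β + 4 * γ - 1) / 24 * cc (α - 1) β γ
    + (20 * γ - 4 * β + 3) / 24 * cc α (β - 1) γ
    + (20 * β - 4 * γ + 3) / 24 * cc α β (γ - 1)
    - 7 * (α + 1) / 6 * cc (α + 1) (β - 1) (γ - 1)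
    - (α + 1) / 12 * cc (α + 1) (β - 2) γ
    - (α + 1) / 12 * cc (α + 1) β (γ - 2)
termination_by (α + β + γ).toNat
decreasing_by all_goals omega

/-- `e_j(0², 1², …, (t-1)²)`, the elementary symmetric function of degree `j`
(with `e_0 = 1`). -/
def esymmSquares (t j : ℕ) : ℕ := ((Multiset.range t).map (fun i => i ^ 2)).esymm j

/-- `∑ c_c(α, β, γ) E₂(q)^α Θ_{β,γ}(q)` over all `α, β, γ ≥ 0` with `α + β + γ = k`. -/
def expansion (k : ℕ) (q : ℂ) : ℂ :=
  ∑ x ∈ Finset.HasAntidiagonal.antidiagonal k, ∑ y ∈ Finset.HasAntidiagonal.antidiagonal x.2,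
    (cc x.1 y.1 y.2 : ℂ) * eisenstein 1 q ^ x.1 * Theta y.1 y.2 q

end

end MacMahonC

/-! Multiplied by `θ₄(q) = ∑ (-1)ⁿ q^(n²)`, MacMahon's series becomes `∑ (-1)ⁿ c_t(n) q^(n²)`, where
`c_t(n) = (-1)^t / (2t)! * ∏ j < t, (n² - j²)` is the coefficient of `X^t` in the Chebyshev
polynomial `T_n(1 - X/2)`. Indeed, with `Q = q^(2s-1)` and `X = 2 - z - z⁻¹` we have
`(1 - zQ)(1 - z⁻¹Q) = (1 - Q)² + QX`, so the coefficient of `X^t` in the Jacobi triple product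
`∏ (1 - zQ)(1 - z⁻¹Q) / (1 - Q)²` is the series in question.

Expanding `c_t(n)` in powers of `n²` turns the right-hand side into a combination of the iterated
derivatives of `θ₄` under `D = q d/dq`. As `E₂`, `θ₂⁴` and `θ₃⁴` satisfy a closed system of
differential equations, each `D^k θ₄ / θ₄` is a polynomial in them; the transpose of the
recursion for `c_c` is `D` acting on monomials.

The theta and Eisenstein identities needed follow from the duplication `q ↦ q²`: a function
holomorphic near `0`, vanishing there, with `f(q) = c f(q²)` on the disc is zero. -/

namespace MacMahonC

open Filter Topology Finset

noncomputable section

section EulerDerivative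

variable {𝕜 : Type*} [NontriviallyNormedField 𝕜] {f g : 𝕜 → 𝕜} {d d' q : 𝕜}

/-- The Euler derivative `q d/dq`: the function `f` is differentiable at `q`, and `q * f' q` is
equal to `d`. -/
def HasEulerDerivAt (f : 𝕜 → 𝕜) (d q : 𝕜) : Prop := ∃ f', HasDerivAt f f' q ∧ q * f' = d

/-- The logarithmic Euler derivative `q f'/f`. It is `0` where `f` vanishes. -/
def eulerLogDeriv (f : 𝕜 → 𝕜) (q : 𝕜) : 𝕜 := q * logDeriv f q

theorem eulerLogDeriv_zero (f : 𝕜 → 𝕜) : eulerLogDeriv f 0 = 0 := zero_mul _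

namespace HasEulerDerivAt

theorem differentiableAt (h : HasEulerDerivAt f d q) : DifferentiableAt 𝕜 f q := by
  obtain ⟨f', h, -⟩ := h
  exact h.differentiableAt

theorem unique (h : HasEulerDerivAt f d q) (h' : HasEulerDerivAt f d' q) : d = d' := by
  obtain ⟨_, h, rfl⟩ := h
  obtain ⟨_, h', rfl⟩ := h'
  rw [h.unique h']

theorem congr_of_eventuallyEq (h : HasEulerDerivAt f d q) (hg : g =ᶠ[𝓝 q] f) :
    HasEulerDerivAt g d q := by
  obtain ⟨f', h, rfl⟩ := h
  exact ⟨f', h.congr_of_eventuallyEq hg, rfl⟩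

theorem congr_deriv (h : HasEulerDerivAt f d q) (hd : d = d') : HasEulerDerivAt f d' q := hd ▸ h

theorem add (hf : HasEulerDerivAt f d q) (hg : HasEulerDerivAt g d' q) :
    HasEulerDerivAt (fun q => f q + g q) (d + d') q := by
  obtain ⟨_, hf, rfl⟩ := hf
  obtain ⟨_, hg, rfl⟩ := hg
  exact ⟨_, hf.add hg, mul_add _ _ _⟩

theorem sub (hf : HasEulerDerivAt f d q) (hg : HasEulerDerivAt g d' q) :
    HasEulerDerivAt (fun q => f q - g q) (d - d') q := by
  obtain ⟨_, hf, rfl⟩ := hf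
  obtain ⟨_, hg, rfl⟩ := hg
  exact ⟨_, hf.sub hg, mul_sub _ _ _⟩

theorem mul (hf : HasEulerDerivAt f d q) (hg : HasEulerDerivAt g d' q) :
    HasEulerDerivAt (fun q => f q * g q) (d * g q + f q * d') q := by
  obtain ⟨_, hf, rfl⟩ := hf
  obtain ⟨_, hg, rfl⟩ := hg
  exact ⟨_, hf.mul hg, by ring⟩

theorem const_mul (c : 𝕜) (hf : HasEulerDerivAt f d q) :
    HasEulerDerivAt (fun q => c * f q) (c * d) q := by
  obtain ⟨_, hf, rfl⟩ := hf
  exact ⟨_, hf.const_mul c, by ring⟩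

theorem pow (hf : HasEulerDerivAt f d q) (n : ℕ) :
    HasEulerDerivAt (fun q => f q ^ n) (n * f q ^ (n - 1) * d) q := by
  obtain ⟨_, hf, rfl⟩ := hf
  exact ⟨_, hf.pow n, by ring⟩

theorem pow_of_eq_mul_self {l : 𝕜} (hf : HasEulerDerivAt f (l * f q) q) (n : ℕ) :
    HasEulerDerivAt (fun q => f q ^ n) (n * l * f q ^ n) q := by
  refine (hf.pow n).congr_deriv ?_
  rcases n with - | n
  · simp
  · rw [Nat.add_sub_cancel]
    ring

theorem sum {ι : Type*} {s : Finset ι} {F : ι → 𝕜 → 𝕜} {D : ι → 𝕜}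
    (h : ∀ i ∈ s, HasEulerDerivAt (F i) (D i) q) :
    HasEulerDerivAt (fun q => ∑ i ∈ s, F i q) (∑ i ∈ s, D i) q := by
  choose! F' hF hD using h
  exact ⟨_, HasDerivAt.fun_sum hF, by rw [mul_sum]; exact sum_congr rfl hD⟩

theorem id (q : 𝕜) : HasEulerDerivAt (fun q => q) q q := ⟨1, hasDerivAt_id q, mul_one q⟩

theorem comp_sq (hf : HasEulerDerivAt f d (q ^ 2)) :
    HasEulerDerivAt (fun q => f (q ^ 2)) (2 * d) q := by
  obtain ⟨_, hf, rfl⟩ := hf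
  exact ⟨_, hf.comp q (hasDerivAt_pow 2 q), by push_cast; ring⟩

end HasEulerDerivAt

theorem hasEulerDerivAt_mul_deriv (hf : DifferentiableAt 𝕜 f q) :
    HasEulerDerivAt f (q * deriv f q) q :=
  ⟨_, hf.hasDerivAt, rfl⟩

theorem hasEulerDerivAt_eulerLogDeriv_mul (hf : DifferentiableAt 𝕜 f q) (h0 : f q ≠ 0) :
    HasEulerDerivAt f (eulerLogDeriv f q * f q) q :=
  ⟨_, hf.hasDerivAt, by rw [eulerLogDeriv, logDeriv_apply, mul_assoc, div_mul_cancel₀ _ h0]⟩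

end EulerDerivative

section Disc

variable {f : ℂ → ℂ} {q : ℂ}

theorem differentiableOn_mul_deriv (hf : DifferentiableOn ℂ f (Metric.ball 0 1)) :
    DifferentiableOn ℂ (fun q => q * deriv f q) (Metric.ball 0 1) :=
  differentiableOn_id.mul (hf.deriv Metric.isOpen_ball)

theorem differentiableOn_eulerLogDeriv (hf : DifferentiableOn ℂ f (Metric.ball 0 1))
    (h0 : ∀ w ∈ Metric.ball (0 : ℂ) 1, f w ≠ 0) :
    DifferentiableOn ℂ (eulerLogDeriv f) (Metric.ball 0 1) :=
  differentiableOn_id.mul ((hf.deriv Metric.isOpen_ball).div hf h0)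

theorem differentiableAt_of_norm_lt_one (hf : DifferentiableOn ℂ f (Metric.ball 0 1))
    (hq : ‖q‖ < 1) : DifferentiableAt ℂ f q :=
  hf.differentiableAt (Metric.isOpen_ball.mem_nhds (mem_ball_zero_iff.2 hq))

theorem eventually_norm_lt_one {𝕜 : Type*} [SeminormedAddGroup 𝕜] {q : 𝕜} (hq : ‖q‖ < 1) :
    ∀ᶠ w in 𝓝 q, ‖w‖ < 1 :=
  continuous_norm.continuousAt.eventually_lt_const hq

theorem norm_sq_lt_one (hq : ‖q‖ < 1) : ‖q ^ 2‖ < 1 := by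
  rw [norm_pow]
  exact pow_lt_one₀ (norm_nonneg q) hq two_ne_zero

theorem norm_pow_two_pow_lt_one (hq : ‖q‖ < 1) (k : ℕ) : ‖q ^ 2 ^ k‖ < 1 := by
  rw [norm_pow]
  exact pow_lt_one₀ (norm_nonneg q) hq (by positivity)

theorem tendsto_pow_two_pow (hq : ‖q‖ < 1) : Tendsto (fun k : ℕ => q ^ 2 ^ k) atTop (𝓝 0) :=
  (tendsto_pow_atTop_nhds_zero_of_norm_lt_one hq).comp
    (tendsto_pow_atTop_atTop_of_one_lt one_lt_two)

theorem tendsto_const_pow_mul_pow_two_pow (c : ℂ) (hq : ‖q‖ < 1) :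
    Tendsto (fun k : ℕ => c ^ k * q ^ 2 ^ k) atTop (𝓝 0) := by
  obtain ⟨m, hm⟩ := pow_unbounded_of_one_lt ‖c‖ one_lt_two
  have hlim := (tendsto_pow_const_mul_const_pow_of_abs_lt_one m (r := ‖q‖)
    (by rwa [abs_norm])).comp (tendsto_pow_atTop_atTop_of_one_lt one_lt_two)
  refine squeeze_zero_norm (fun k => ?_) hlim
  simp only [Function.comp_apply, norm_mul, norm_pow, Nat.cast_pow, Nat.cast_ofNat]
  rw [pow_right_comm]
  gcongr

theorem eq_zero_of_eq_const_mul_sq {c : ℂ} (hf : DifferentiableAt ℂ f 0) (h0 : f 0 = 0)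
    (h : ∀ w : ℂ, ‖w‖ < 1 → f w = c * f (w ^ 2)) (hq : ‖q‖ < 1) : f q = 0 := by
  have iterate (k : ℕ) : f q = c ^ k * f (q ^ 2 ^ k) := by
    induction k with
    | zero => simp
    | succ k ih =>
      rw [ih, h _ (norm_pow_two_pow_lt_one hq k), ← pow_mul, ← pow_succ 2, pow_succ c, mul_assoc]
  have hO : (fun k : ℕ => f (q ^ 2 ^ k)) =O[atTop] fun k => q ^ 2 ^ k := by
    simpa only [Function.comp_def, h0, sub_zero] using
      hf.isBigO_sub.comp_tendsto (tendsto_pow_two_pow hq)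
  have hlim := ((Asymptotics.isBigO_refl (fun k : ℕ => c ^ k) atTop).mul hO).trans_tendsto
    (tendsto_const_pow_mul_pow_two_pow c hq)
  exact tendsto_nhds_unique tendsto_const_nhds (hlim.congr fun k => (iterate k).symm)

theorem eq_apply_zero_of_eq_comp_sq (hf : DifferentiableAt ℂ f 0)
    (h : ∀ w : ℂ, ‖w‖ < 1 → f w = f (w ^ 2)) (hq : ‖q‖ < 1) : f q = f 0 :=
  sub_eq_zero.1 (eq_zero_of_eq_const_mul_sq (f := fun w => f w - f 0) (c := 1) (hf.sub_const _)
    (sub_self _) (fun w hw => by rw [h w hw, one_mul]) hq)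

theorem ne_zero_of_zero_imp_sq_zero (hf : ContinuousAt f 0) (h0 : f 0 ≠ 0)
    (h : ∀ w : ℂ, ‖w‖ < 1 → f w = 0 → f (w ^ 2) = 0) (hq : ‖q‖ < 1) : f q ≠ 0 := by
  intro hz
  have iterate (k : ℕ) : f (q ^ 2 ^ k) = 0 := by
    induction k with
    | zero => simpa using hz
    | succ k ih =>
      rw [pow_succ, pow_mul]
      exact h _ (norm_pow_two_pow_lt_one hq k) ih
  exact h0 (tendsto_nhds_unique (hf.tendsto.comp (tendsto_pow_two_pow hq))
    (tendsto_const_nhds.congr fun k => (iterate k).symm))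

end Disc

section SummableOnDisc

/-- The family of monomials `c n * q ^ e n` is absolutely summable at every point of the open unit
disc. -/
def SummableOnDisc {ι : Type*} (c : ι → ℂ) (e : ι → ℕ) : Prop :=
  ∀ r : ℝ, 0 ≤ r → r < 1 → Summable fun n => ‖c n‖ * r ^ e n

theorem exists_natCast_mul_pow_le {r s : ℝ} (hr : 0 ≤ r) (hs : r < s) :
    ∃ K : ℝ, ∀ m : ℕ, (m : ℝ) * r ^ m ≤ K * s ^ m := by
  have hs0 : 0 < s := hr.trans_lt hs
  have hrs : |r / s| < 1 := by rwa [abs_of_nonneg (by positivity), div_lt_one hs0]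
  obtain ⟨K, hK⟩ := (tendsto_self_mul_const_pow_of_abs_lt_one hrs).bddAbove_range
  refine ⟨K, fun m => ?_⟩
  have hm : (m : ℝ) * (r / s) ^ m ≤ K := hK ⟨m, rfl⟩
  rwa [div_pow, ← mul_div_assoc, div_le_iff₀ (by positivity)] at hm

namespace SummableOnDisc

variable {ι : Type*} {c : ι → ℂ} {e : ι → ℕ} {q : ℂ}

theorem summable_norm (h : SummableOnDisc c e) (hq : ‖q‖ < 1) :
    Summable fun n => ‖c n * q ^ e n‖ := by
  simpa only [norm_mul, norm_pow] using h ‖q‖ (norm_nonneg q) hq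

theorem summable (h : SummableOnDisc c e) (hq : ‖q‖ < 1) : Summable fun n => c n * q ^ e n :=
  (h.summable_norm hq).of_norm

theorem natCast_mul (h : SummableOnDisc c e) : SummableOnDisc (fun n => e n * c n) e := by
  intro r hr hr1
  obtain ⟨s, hs, hs1⟩ := exists_between hr1
  obtain ⟨K, hK⟩ := exists_natCast_mul_pow_le hr hs
  refine ((h s (hr.trans hs.le) hs1).mul_left K).of_nonneg_of_le (fun n => by positivity)
    fun n => ?_
  rw [norm_mul, Complex.norm_natCast]
  calc (e n : ℝ) * ‖c n‖ * r ^ e n = ‖c n‖ * (e n * r ^ e n) := by ring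
    _ ≤ ‖c n‖ * (K * s ^ e n) := mul_le_mul_of_nonneg_left (hK _) (norm_nonneg _)
    _ = K * (‖c n‖ * s ^ e n) := by ring

theorem hasEulerDerivAt_tsum (h : SummableOnDisc c e) (hq : ‖q‖ < 1) :
    HasEulerDerivAt (fun q => ∑' n, c n * q ^ e n) (∑' n, e n * c n * q ^ e n) q := by
  obtain ⟨s, hs, hs1⟩ := exists_between hq
  have hdiff : ∀ n, DifferentiableOn ℂ (fun q => c n * q ^ e n) (Metric.ball 0 s) :=
    fun n => by fun_prop
  have hbound : ∀ n, ∀ w ∈ Metric.ball (0 : ℂ) s, ‖c n * w ^ e n‖ ≤ ‖c n‖ * s ^ e n := by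
    intro n w hw
    rw [norm_mul, norm_pow]
    gcongr
    exact (mem_ball_zero_iff.1 hw).le
  have hsum := h s ((norm_nonneg q).trans hs.le) hs1
  have hmem : Metric.ball 0 s ∈ 𝓝 q := Metric.isOpen_ball.mem_nhds (mem_ball_zero_iff.2 hs)
  refine ⟨_, ((Complex.differentiableOn_tsum_of_summable_norm hsum hdiff Metric.isOpen_ball
    hbound).differentiableAt hmem).hasDerivAt, ?_⟩
  rw [← (Complex.hasSum_deriv_of_summable_norm hsum hdiff Metric.isOpen_ball hbound
    (mem_of_mem_nhds hmem)).tsum_eq, ← tsum_mul_left]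
  refine tsum_congr fun n => ?_
  rw [deriv_const_mul _ (by fun_prop), deriv_pow_field]
  rcases e n with - | m
  · simp
  · rw [Nat.add_sub_cancel]
    ring

theorem differentiableOn_tsum (h : SummableOnDisc c e) :
    DifferentiableOn ℂ (fun q => ∑' n, c n * q ^ e n) (Metric.ball 0 1) := fun _ hq =>
  (h.hasEulerDerivAt_tsum (mem_ball_zero_iff.1 hq)).differentiableAt.differentiableWithinAt

end SummableOnDisc

end SummableOnDisc

section Theta

/-- The theta function `θ₄(q) = ∑ (-1)ⁿ q^(n²)`, encoded through `(-1)ⁿ = (-1)^(n²)`. -/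
def theta4 (q : ℂ) : ℂ := theta3 (-q)

/-- The series `ψ(q) = ∑ q^(n(n+1)) = q^(-1/4) θ₂(q)`, which, unlike `θ₂`, is holomorphic at `0`. -/
def psi (q : ℂ) : ℂ := ∑' n : ℤ, 1 * q ^ (n * (n + 1)).natAbs

/-- The moments `∑ (-1)ⁿ n^(2k) q^(n²)` of `θ₄`, equal to `(q d/dq)^k θ₄`. -/
def theta4Moment (k : ℕ) (q : ℂ) : ℂ :=
  ∑' n : ℤ, (-1) ^ n * (n : ℂ) ^ (2 * k) * q ^ n.natAbs ^ 2

variable {q : ℂ}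

theorem abs_mul_add_one (n : ℤ) : |n * (n + 1)| = n * (n + 1) := by
  refine abs_of_nonneg ?_
  rcases le_or_gt 0 n with h | h
  · exact mul_nonneg h (by omega)
  · exact mul_nonneg_of_nonpos_of_nonpos h.le (by omega)

theorem natCast_natAbs_sq (n : ℤ) : ((n.natAbs ^ 2 : ℕ) : ℂ) = (n : ℂ) ^ 2 := by
  rw [← Int.cast_natCast, Nat.cast_pow, Int.natAbs_sq, Int.cast_pow]

theorem neg_one_pow_natAbs_sq (n : ℤ) : (-1 : ℂ) ^ n.natAbs ^ 2 = (-1) ^ n := by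
  rcases n.even_or_odd with h | h
  · rw [h.neg_one_zpow, ((Int.natAbs_even.2 h).pow_of_ne_zero two_ne_zero).neg_one_pow]
  · rw [h.neg_one_zpow, ((Int.natAbs_odd.2 h).pow).neg_one_pow]

theorem theta3_eq_tsum (q : ℂ) : theta3 q = ∑' n : ℤ, 1 * q ^ n.natAbs ^ 2 := by
  refine tsum_congr fun n => ?_
  rw [one_mul, ← zpow_natCast, Nat.cast_pow, Int.natAbs_sq]

theorem theta4_eq_tsum (q : ℂ) : theta4 q = ∑' n : ℤ, (-1) ^ n * q ^ n.natAbs ^ 2 := by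
  rw [theta4, theta3_eq_tsum]
  refine tsum_congr fun n => ?_
  rw [one_mul, neg_pow, neg_one_pow_natAbs_sq]

theorem theta4_neg (q : ℂ) : theta4 (-q) = theta3 q := by rw [theta4, neg_neg]

theorem theta4Moment_zero (q : ℂ) : theta4Moment 0 q = theta4 q := by
  simp only [theta4Moment, theta4_eq_tsum, mul_zero, pow_zero, mul_one]

theorem theta2_zero : theta2 0 = 0 := by
  refine (tsum_congr fun n => Complex.zero_cpow (pow_ne_zero 2 fun h => ?_)).trans tsum_zero
  have h2 : ((2 * n + 1 : ℤ) : ℂ) = 0 := by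
    push_cast
    linear_combination 2 * h
  have : 2 * n + 1 = 0 := mod_cast h2
  omega

theorem theta2_eq_cpow_mul_psi (h0 : q ≠ 0) : theta2 q = q ^ (1 / 4 : ℂ) * psi q := by
  rw [theta2, psi, ← tsum_mul_left]
  refine tsum_congr fun n => ?_
  rw [show ((n : ℂ) + 1 / 2) ^ 2 = 1 / 4 + ((n * (n + 1) : ℤ) : ℂ) by push_cast; ring,
    Complex.cpow_add _ _ h0, Complex.cpow_intCast, one_mul, ← zpow_natCast, Int.natCast_natAbs,
    abs_mul_add_one]

theorem theta2_pow_four (q : ℂ) : theta2 q ^ 4 = q * psi q ^ 4 := by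
  rcases eq_or_ne q 0 with rfl | h0
  · rw [theta2_zero, zero_mul, zero_pow four_ne_zero]
  · rw [theta2_eq_cpow_mul_psi h0, mul_pow, ← Complex.cpow_nat_mul]
    norm_num

theorem summableOnDisc_of_natAbs_le {c : ℤ → ℂ} {e : ℤ → ℕ} (hc : ∀ n, ‖c n‖ ≤ 1)
    (he : ∀ n, n.natAbs ≤ e n + 1) : SummableOnDisc c e := by
  intro r h0 h1
  have hgeom : Summable fun n : ℕ => r ^ (n - 1) :=
    (summable_nat_add_iff 1).1 (by simpa using summable_geometric_of_lt_one h0 h1)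
  have habs : Summable fun n : ℤ => r ^ (n.natAbs - 1) :=
    .of_nat_of_neg (by simpa using hgeom) (by simpa using hgeom)
  refine habs.of_nonneg_of_le (fun n => by positivity) fun n => ?_
  calc ‖c n‖ * r ^ e n ≤ 1 * r ^ (n.natAbs - 1) := by
        gcongr ?_ * ?_
        · exact hc n
        · exact pow_le_pow_of_le_one h0 h1.le (Nat.sub_le_iff_le_add.2 (he n))
    _ = r ^ (n.natAbs - 1) := one_mul _

theorem natAbs_le_sq_add_one (n : ℤ) : n.natAbs ≤ n.natAbs ^ 2 + 1 :=
  (Nat.le_self_pow two_ne_zero _).trans (Nat.le_succ _)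

theorem summableOnDisc_theta3 : SummableOnDisc (fun _ : ℤ => 1) fun n => n.natAbs ^ 2 :=
  summableOnDisc_of_natAbs_le (fun _ => norm_one.le) natAbs_le_sq_add_one

theorem summableOnDisc_psi : SummableOnDisc (fun _ : ℤ => 1) fun n => (n * (n + 1)).natAbs := by
  refine summableOnDisc_of_natAbs_le (fun _ => norm_one.le) fun n => ?_
  zify
  rw [abs_mul_add_one, abs_le]
  constructor <;> nlinarith [sq_nonneg n, sq_nonneg (n + 1)]

theorem summableOnDisc_theta4Moment (k : ℕ) :
    SummableOnDisc (fun n : ℤ => (-1) ^ n * (n : ℂ) ^ (2 * k)) fun n => n.natAbs ^ 2 := by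
  induction k with
  | zero => exact summableOnDisc_of_natAbs_le (fun n => by simp) natAbs_le_sq_add_one
  | succ k ih =>
    convert ih.natCast_mul using 2 with n
    rw [natCast_natAbs_sq]
    ring

theorem hasEulerDerivAt_theta4Moment (k : ℕ) (hq : ‖q‖ < 1) :
    HasEulerDerivAt (theta4Moment k) (theta4Moment (k + 1) q) q :=
  ((summableOnDisc_theta4Moment k).hasEulerDerivAt_tsum hq).congr_deriv <| tsum_congr fun n => by
    rw [natCast_natAbs_sq]
    ring

theorem differentiableOn_theta3 : DifferentiableOn ℂ theta3 (Metric.ball 0 1) :=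
  summableOnDisc_theta3.differentiableOn_tsum.congr fun q _ => theta3_eq_tsum q

theorem differentiableOn_theta4 : DifferentiableOn ℂ theta4 (Metric.ball 0 1) :=
  differentiableOn_theta3.comp differentiableOn_id.neg fun q hq => by
    simpa only [Pi.neg_apply, id, mem_ball_zero_iff, norm_neg] using hq

theorem differentiableOn_psi : DifferentiableOn ℂ psi (Metric.ball 0 1) :=
  summableOnDisc_psi.differentiableOn_tsum

theorem theta3_zero : theta3 0 = 1 := by
  rw [theta3_eq_tsum, tsum_eq_single 0 fun n hn => by simp [hn]]
  simp

theorem theta4_zero : theta4 0 = 1 := by rw [theta4, neg_zero, theta3_zero]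

theorem psi_zero : psi 0 = 2 := by
  rw [psi, tsum_eq_sum (s := {0, -1}) fun n hn => ?_]
  · rw [Finset.sum_pair (by norm_num)]
    norm_num
  · simp only [Finset.mem_insert, Finset.mem_singleton, not_or] at hn
    rw [one_mul, zero_pow (Int.natAbs_ne_zero.2 (mul_ne_zero hn.1 (by omega)))]

end Theta

section Duplication

variable {q : ℂ}

/-- The splitting of the pairs of integers `(m, n)` by the parity of `m + n`, into the pairs
`(i + j, i - j)` and the pairs `(i + j + 1, i - j)`. -/
def parityEquiv : (ℤ × ℤ) ⊕ (ℤ × ℤ) ≃ ℤ × ℤ where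
  toFun := Sum.elim (fun p => (p.1 + p.2, p.1 - p.2)) (fun p => (p.1 + p.2 + 1, p.1 - p.2))
  invFun p := if (p.1 + p.2) % 2 = 0 then Sum.inl ((p.1 + p.2) / 2, (p.1 - p.2) / 2)
    else Sum.inr ((p.1 + p.2 - 1) / 2, (p.1 - p.2 - 1) / 2)
  left_inv := by
    rintro (⟨i, j⟩ | ⟨i, j⟩)
    · have h : (i + j + (i - j)) % 2 = 0 := by omega
      simp only [Sum.elim_inl, h, if_true, Sum.inl.injEq, Prod.mk.injEq]
      omega
    · have h : ¬ (i + j + 1 + (i - j)) % 2 = 0 := by omega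
      simp only [Sum.elim_inr, h, if_false, Sum.inr.injEq, Prod.mk.injEq]
      omega
  right_inv := by
    rintro ⟨m, n⟩
    by_cases h : (m + n) % 2 = 0
    · simp only [h, if_true, Sum.elim_inl, Prod.mk.injEq]
      omega
    · simp only [h, if_false, Sum.elim_inr, Prod.mk.injEq]
      omega

theorem tsum_mul_tsum_eq_parity {R : Type*} [NormedRing R] [CompleteSpace R] {f g : ℤ → R}
    (hf : Summable fun n => ‖f n‖) (hg : Summable fun n => ‖g n‖) :
    (∑' n, f n) * ∑' n, g n = ∑' p : ℤ × ℤ, f (p.1 + p.2) * g (p.1 - p.2) +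
      ∑' p : ℤ × ℤ, f (p.1 + p.2 + 1) * g (p.1 - p.2) := by
  have hs := parityEquiv.summable_iff.2 (summable_mul_of_summable_norm hf hg)
  rw [tsum_mul_tsum_of_summable_norm hf hg, ← parityEquiv.tsum_eq]
  exact Summable.tsum_sum (hs.comp_injective Sum.inl_injective)
    (hs.comp_injective Sum.inr_injective)

theorem theta3_sq (hq : ‖q‖ < 1) :
    theta3 q ^ 2 = theta3 (q ^ 2) ^ 2 + q * psi (q ^ 2) ^ 2 := by
  have h3 := summableOnDisc_theta3.summable_norm hq
  have h3' := summableOnDisc_theta3.summable_norm (norm_sq_lt_one hq)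
  have hp' := summableOnDisc_psi.summable_norm (norm_sq_lt_one hq)
  rw [sq (theta3 q), sq (theta3 _), sq (psi _)]
  simp only [theta3_eq_tsum, psi]
  rw [tsum_mul_tsum_eq_parity h3 h3, tsum_mul_tsum_of_summable_norm h3' h3',
    tsum_mul_tsum_of_summable_norm hp' hp', ← tsum_mul_left]
  congr 1 <;> refine tsum_congr fun p => ?_ <;>
    simp only [one_mul, ← pow_mul, ← pow_add, ← pow_succ'] <;> congr 1 <;> zify <;>
    simp only [sq_abs, abs_mul_add_one] <;> ring

theorem theta4_sq (hq : ‖q‖ < 1) :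
    theta4 q ^ 2 = theta3 (q ^ 2) ^ 2 - q * psi (q ^ 2) ^ 2 := by
  rw [theta4, theta3_sq (by rwa [norm_neg]), neg_sq]
  ring

theorem psi_sq (hq : ‖q‖ < 1) : psi q ^ 2 = 2 * psi (q ^ 2) * theta3 (q ^ 2) := by
  have hp := summableOnDisc_psi.summable_norm hq
  have h3' := summableOnDisc_theta3.summable_norm (norm_sq_lt_one hq)
  have hp' := summableOnDisc_psi.summable_norm (norm_sq_lt_one hq)
  rw [sq, show 2 * psi (q ^ 2) * theta3 (q ^ 2) =
    psi (q ^ 2) * theta3 (q ^ 2) + theta3 (q ^ 2) * psi (q ^ 2) by ring]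
  simp only [theta3_eq_tsum, psi]
  rw [tsum_mul_tsum_eq_parity hp hp, tsum_mul_tsum_of_summable_norm hp' h3',
    tsum_mul_tsum_of_summable_norm h3' hp',
    ← ((Equiv.addRight (1 : ℤ)).prodCongr (Equiv.refl ℤ)).tsum_eq fun p : ℤ × ℤ =>
      1 * (q ^ 2) ^ p.1.natAbs ^ 2 * (1 * (q ^ 2) ^ (p.2 * (p.2 + 1)).natAbs)]
  congr 1 <;> refine tsum_congr fun p => ?_ <;>
    simp only [one_mul, ← pow_mul, ← pow_add, Equiv.prodCongr_apply, Prod.map_fst, Prod.map_snd,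
      Equiv.coe_addRight, Equiv.refl_apply] <;> congr 1 <;> zify <;>
    simp only [sq_abs, abs_mul_add_one] <;> ring

theorem theta2_pow_four_duplication (hq : ‖q‖ < 1) :
    theta2 q ^ 4 = 4 * (q * psi (q ^ 2) ^ 2) * theta3 (q ^ 2) ^ 2 := by
  linear_combination theta2_pow_four q +
    q * (psi q ^ 2 + 2 * psi (q ^ 2) * theta3 (q ^ 2)) * psi_sq hq

theorem theta3_pow_four_sub_theta2_pow_four (hq : ‖q‖ < 1) :
    theta3 q ^ 4 - theta2 q ^ 4 = theta4 q ^ 4 := by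
  rw [theta2_pow_four_duplication hq, pow_mul _ 2 2, pow_mul _ 2 2, theta3_sq hq, theta4_sq hq]
  ring

theorem theta3_sq_mul_theta4_sq (hq : ‖q‖ < 1) :
    theta3 q ^ 2 * theta4 q ^ 2 = theta4 (q ^ 2) ^ 4 := by
  rw [theta3_sq hq, theta4_sq hq, ← theta3_pow_four_sub_theta2_pow_four (norm_sq_lt_one hq),
    theta2_pow_four]
  ring

theorem theta4_ne_zero (hq : ‖q‖ < 1) : theta4 q ≠ 0 := by
  have hcont := (differentiableAt_of_norm_lt_one differentiableOn_theta4
    (by simp : ‖(0 : ℂ)‖ < 1)).continuousAt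
  refine ne_zero_of_zero_imp_sq_zero hcont (by simp [theta4_zero]) (fun w hw h => ?_) hq
  exact pow_eq_zero_iff four_ne_zero |>.1 (by simp [← theta3_sq_mul_theta4_sq hw, h])

theorem theta3_ne_zero (hq : ‖q‖ < 1) : theta3 q ≠ 0 := by
  rw [← theta4_neg]
  exact theta4_ne_zero (by rwa [norm_neg])

theorem psi_ne_zero (hq : ‖q‖ < 1) : psi q ≠ 0 := by
  have hcont := (differentiableAt_of_norm_lt_one differentiableOn_psi
    (by simp : ‖(0 : ℂ)‖ < 1)).continuousAt
  refine ne_zero_of_zero_imp_sq_zero hcont (by simp [psi_zero]) (fun w hw h => ?_) hq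
  simpa [h, theta3_ne_zero (norm_sq_lt_one hw)] using psi_sq hw

end Duplication

section LogDerivatives

variable {q : ℂ}

/-- The logarithmic Euler derivative of `θ₂ = q^(1/4) ψ`, continued holomorphically to `0`. -/
def logD2 (q : ℂ) : ℂ := 1 / 4 + eulerLogDeriv psi q

/-- The logarithmic Euler derivative of `θ₃`. -/
def logD3 (q : ℂ) : ℂ := eulerLogDeriv theta3 q

/-- The logarithmic Euler derivative of `θ₄`. -/
def logD4 (q : ℂ) : ℂ := eulerLogDeriv theta4 q

theorem logD2_zero : logD2 0 = 1 / 4 := by rw [logD2, eulerLogDeriv_zero, add_zero]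

theorem logD3_zero : logD3 0 = 0 := eulerLogDeriv_zero _

theorem logD4_zero : logD4 0 = 0 := eulerLogDeriv_zero _

theorem hasEulerDerivAt_psi (hq : ‖q‖ < 1) :
    HasEulerDerivAt psi ((logD2 q - 1 / 4) * psi q) q :=
  (hasEulerDerivAt_eulerLogDeriv_mul (differentiableAt_of_norm_lt_one differentiableOn_psi hq)
    (psi_ne_zero hq)).congr_deriv (by rw [logD2, add_sub_cancel_left])

theorem hasEulerDerivAt_theta3 (hq : ‖q‖ < 1) :
    HasEulerDerivAt theta3 (logD3 q * theta3 q) q :=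
  hasEulerDerivAt_eulerLogDeriv_mul (differentiableAt_of_norm_lt_one differentiableOn_theta3 hq)
    (theta3_ne_zero hq)

theorem hasEulerDerivAt_theta4 (hq : ‖q‖ < 1) :
    HasEulerDerivAt theta4 (logD4 q * theta4 q) q :=
  hasEulerDerivAt_eulerLogDeriv_mul (differentiableAt_of_norm_lt_one differentiableOn_theta4 hq)
    (theta4_ne_zero hq)

theorem hasEulerDerivAt_theta2_pow_four (hq : ‖q‖ < 1) :
    HasEulerDerivAt (fun q => theta2 q ^ 4) (4 * logD2 q * theta2 q ^ 4) q := by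
  simp only [theta2_pow_four]
  exact ((HasEulerDerivAt.id q).mul ((hasEulerDerivAt_psi hq).pow 4)).congr_deriv
    (by push_cast; ring)

theorem hasEulerDerivAt_theta3_pow_four (hq : ‖q‖ < 1) :
    HasEulerDerivAt (fun q => theta3 q ^ 4) (4 * logD3 q * theta3 q ^ 4) q :=
  (hasEulerDerivAt_theta3 hq).pow_of_eq_mul_self 4

theorem differentiableOn_logD2 : DifferentiableOn ℂ logD2 (Metric.ball 0 1) :=
  (differentiableOn_const _).add (differentiableOn_eulerLogDeriv differentiableOn_psi
    fun _ hw => psi_ne_zero (mem_ball_zero_iff.1 hw))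

theorem differentiableOn_logD3 : DifferentiableOn ℂ logD3 (Metric.ball 0 1) :=
  differentiableOn_eulerLogDeriv differentiableOn_theta3
    fun _ hw => theta3_ne_zero (mem_ball_zero_iff.1 hw)

theorem differentiableOn_logD4 : DifferentiableOn ℂ logD4 (Metric.ball 0 1) :=
  differentiableOn_eulerLogDeriv differentiableOn_theta4
    fun _ hw => theta4_ne_zero (mem_ball_zero_iff.1 hw)

theorem logD3_duplication (hq : ‖q‖ < 1) :
    logD3 q * theta3 q ^ 2 =
      2 * (logD3 (q ^ 2) * theta3 (q ^ 2) ^ 2 + logD2 (q ^ 2) * (q * psi (q ^ 2) ^ 2)) := by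
  have hq2 := norm_sq_lt_one hq
  have h := ((hasEulerDerivAt_theta3 hq).pow 2).unique
    (((hasEulerDerivAt_theta3 hq2).comp_sq.pow 2).add ((HasEulerDerivAt.id q).mul
      ((hasEulerDerivAt_psi hq2).comp_sq.pow 2)) |>.congr_of_eventuallyEq
        ((eventually_norm_lt_one hq).mono fun w hw => theta3_sq hw))
  push_cast at h
  linear_combination (1 / 2) * h

theorem logD4_duplication (hq : ‖q‖ < 1) :
    logD4 q * theta4 q ^ 2 =
      2 * (logD3 (q ^ 2) * theta3 (q ^ 2) ^ 2 - logD2 (q ^ 2) * (q * psi (q ^ 2) ^ 2)) := by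
  have hq2 := norm_sq_lt_one hq
  have h := ((hasEulerDerivAt_theta4 hq).pow 2).unique
    (((hasEulerDerivAt_theta3 hq2).comp_sq.pow 2).sub ((HasEulerDerivAt.id q).mul
      ((hasEulerDerivAt_psi hq2).comp_sq.pow 2)) |>.congr_of_eventuallyEq
        ((eventually_norm_lt_one hq).mono fun w hw => theta4_sq hw))
  push_cast at h
  linear_combination (1 / 2) * h

theorem logD2_duplication (hq : ‖q‖ < 1) : logD2 q = logD2 (q ^ 2) + logD3 (q ^ 2) := by
  have hq2 := norm_sq_lt_one hq
  have h := ((hasEulerDerivAt_psi hq).pow 2).unique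
    (((hasEulerDerivAt_psi hq2).comp_sq.const_mul 2).mul (hasEulerDerivAt_theta3 hq2).comp_sq
      |>.congr_of_eventuallyEq ((eventually_norm_lt_one hq).mono fun w hw => psi_sq hw))
  push_cast at h
  refine mul_right_cancel₀ (pow_ne_zero 2 (psi_ne_zero hq)) ?_
  linear_combination (1 / 2) * h + (1 / 4 - logD2 (q ^ 2) - logD3 (q ^ 2)) * psi_sq hq

theorem logD3_add_logD4 (hq : ‖q‖ < 1) : logD3 q + logD4 q = 4 * logD4 (q ^ 2) := by
  have hq2 := norm_sq_lt_one hq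
  have h := (((hasEulerDerivAt_theta3 hq).pow 2).mul ((hasEulerDerivAt_theta4 hq).pow 2)).unique
    ((hasEulerDerivAt_theta4 hq2).comp_sq.pow 4 |>.congr_of_eventuallyEq
      ((eventually_norm_lt_one hq).mono fun w hw => theta3_sq_mul_theta4_sq hw))
  push_cast at h
  refine mul_right_cancel₀ (pow_ne_zero 4 (theta4_ne_zero hq2)) ?_
  linear_combination (1 / 2) * h - (logD3 q + logD4 q) * theta3_sq_mul_theta4_sq hq

theorem logD2_sub_logD3 (hq : ‖q‖ < 1) : logD2 q - logD3 q = theta4 q ^ 4 / 4 := by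
  -- The quotient `(logD2 - logD3) / θ₄⁴` is invariant under `q ↦ q²`.
  have hd : DifferentiableOn ℂ (fun q => (logD2 q - logD3 q) / theta4 q ^ 4) (Metric.ball 0 1) :=
    (differentiableOn_logD2.sub differentiableOn_logD3).div (differentiableOn_theta4.pow 4)
      fun _ hw => pow_ne_zero 4 (theta4_ne_zero (mem_ball_zero_iff.1 hw))
  have invariant (w : ℂ) (hw : ‖w‖ < 1) : (logD2 w - logD3 w) / theta4 w ^ 4 =
      (logD2 (w ^ 2) - logD3 (w ^ 2)) / theta4 (w ^ 2) ^ 4 := by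
    rw [div_eq_div_iff (pow_ne_zero 4 (theta4_ne_zero hw))
      (pow_ne_zero 4 (theta4_ne_zero (norm_sq_lt_one hw)))]
    have h3 := logD3_duplication hw
    have h33 := theta3_sq hw
    have h4 := theta4_sq hw
    rw [← theta3_sq_mul_theta4_sq hw, logD2_duplication hw]
    linear_combination -theta4 w ^ 2 * h3 + theta4 w ^ 2 * (logD2 (w ^ 2) + logD3 (w ^ 2)) * h33
      - theta4 w ^ 2 * (logD2 (w ^ 2) - logD3 (w ^ 2)) * h4
  have h := eq_apply_zero_of_eq_comp_sq
    (differentiableAt_of_norm_lt_one hd (by simp)) invariant hq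
  rw [div_eq_iff (pow_ne_zero 4 (theta4_ne_zero hq)), logD2_zero, logD3_zero, theta4_zero] at h
  linear_combination h

theorem logD3_sub_logD4 (hq : ‖q‖ < 1) : logD3 q - logD4 q = theta2 q ^ 4 / 4 := by
  have hq2 := norm_sq_lt_one hq
  refine mul_right_cancel₀ (pow_ne_zero 4 (theta4_ne_zero hq2)) ?_
  have h3 := logD3_duplication hq
  have h4 := logD4_duplication hq
  have h23 := logD2_sub_logD3 hq2
  rw [← theta3_sq_mul_theta4_sq hq, theta3_sq hq, theta4_sq hq] at h23 ⊢
  rw [theta3_sq hq] at h3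
  rw [theta4_sq hq] at h4
  rw [theta2_pow_four_duplication hq]
  linear_combination (theta3 (q ^ 2) ^ 2 - q * psi (q ^ 2) ^ 2) * h3 -
    (theta3 (q ^ 2) ^ 2 + q * psi (q ^ 2) ^ 2) * h4 +
    4 * (q * psi (q ^ 2) ^ 2) * theta3 (q ^ 2) ^ 2 * h23

theorem logD2_sub_logD4 (hq : ‖q‖ < 1) : logD2 q - logD4 q = theta3 q ^ 4 / 4 := by
  linear_combination logD2_sub_logD3 hq + logD3_sub_logD4 hq -
    theta3_pow_four_sub_theta2_pow_four hq / 4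

theorem logD4_sq (hq : ‖q‖ < 1) : logD4 (q ^ 2) = logD4 q / 2 + theta2 q ^ 4 / 16 := by
  linear_combination (1 / 4) * logD3_sub_logD4 hq - (1 / 4) * logD3_add_logD4 hq

theorem deriv_logD4_duplication (hq : ‖q‖ < 1) :
    4 * (q ^ 2 * deriv logD4 (q ^ 2)) = q * deriv logD4 q + logD2 q * theta2 q ^ 4 / 2 := by
  have hasDeriv {w : ℂ} (hw : ‖w‖ < 1) : HasEulerDerivAt logD4 (w * deriv logD4 w) w :=
    hasEulerDerivAt_mul_deriv (differentiableAt_of_norm_lt_one differentiableOn_logD4 hw)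
  have h := (hasDeriv (norm_sq_lt_one hq)).comp_sq.unique
    (((hasDeriv hq).const_mul (1 / 2)).add
      ((hasEulerDerivAt_theta2_pow_four hq).const_mul (1 / 16)) |>.congr_of_eventuallyEq
        ((eventually_norm_lt_one hq).mono fun w hw => (logD4_sq hw).trans (by ring)))
  linear_combination 2 * h

theorem mul_deriv_logD4 (hq : ‖q‖ < 1) :
    q * deriv logD4 q = 2 * logD4 q ^ 2 - theta2 q ^ 4 * theta3 q ^ 4 / 8 := by
  have hd : DifferentiableAt ℂ
      (fun q => q * deriv logD4 q - 2 * logD4 q ^ 2 + theta2 q ^ 4 * theta3 q ^ 4 / 8) 0 := by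
    have h0 : ‖(0 : ℂ)‖ < 1 := by simp
    exact (((differentiableAt_of_norm_lt_one (differentiableOn_mul_deriv differentiableOn_logD4)
      h0).sub (((differentiableAt_of_norm_lt_one differentiableOn_logD4 h0).pow 2).const_mul
      2)).add (((hasEulerDerivAt_theta2_pow_four h0).mul
      (hasEulerDerivAt_theta3_pow_four h0)).differentiableAt.div_const 8))
  have duplication (w : ℂ) (hw : ‖w‖ < 1) :
      w * deriv logD4 w - 2 * logD4 w ^ 2 + theta2 w ^ 4 * theta3 w ^ 4 / 8 =
        4 * (w ^ 2 * deriv logD4 (w ^ 2) - 2 * logD4 (w ^ 2) ^ 2 +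
          theta2 (w ^ 2) ^ 4 * theta3 (w ^ 2) ^ 4 / 8) := by
    have hprod : theta2 (w ^ 2) ^ 4 * theta3 (w ^ 2) ^ 4 = (theta2 w ^ 4) ^ 2 / 16 := by
      rw [theta2_pow_four_duplication hw, theta2_pow_four (w ^ 2)]
      ring
    rw [hprod, logD4_sq hw]
    linear_combination -deriv_logD4_duplication hw - theta2 w ^ 4 / 2 * logD2_sub_logD4 hw
  have h := eq_zero_of_eq_const_mul_sq hd (by simp [logD4_zero, theta2_zero]) duplication hq
  linear_combination h

end LogDerivatives

section CentralFactorial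

variable {R : Type*} [CommRing R]

/-- The central factorial `∏_{j < t} (x² - j²)`. -/
def centralFactorial (t : ℕ) (x : R) : R := ∏ j ∈ range t, (x ^ 2 - (j : R) ^ 2)

theorem centralFactorial_zero (x : R) : centralFactorial 0 x = 1 := prod_range_zero _

theorem centralFactorial_succ (t : ℕ) (x : R) :
    centralFactorial (t + 1) x = centralFactorial t x * (x ^ 2 - (t : R) ^ 2) :=
  prod_range_succ _ _

theorem centralFactorial_neg (t : ℕ) (x : R) : centralFactorial t (-x) = centralFactorial t x := by
  simp only [centralFactorial, neg_sq]

theorem mul_centralFactorial_add_one (t : ℕ) (x : R) :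
    x * centralFactorial (t + 1) (x + 1) =
      (x + 1) * (x + t) * (x + t + 1) * centralFactorial t x := by
  induction t with
  | zero =>
    simp only [centralFactorial_succ, centralFactorial_zero]
    push_cast
    ring
  | succ t ih =>
    rw [centralFactorial_succ (t + 1), ← mul_assoc, ih, centralFactorial_succ]
    push_cast
    ring

theorem mul_centralFactorial_sub_one (t : ℕ) (x : R) :
    x * centralFactorial (t + 1) (x - 1) =
      (x - 1) * (x - t) * (x - t - 1) * centralFactorial t x := by
  have h := mul_centralFactorial_add_one t (-x)
  rw [← centralFactorial_neg, neg_add, neg_neg, ← sub_eq_add_neg, centralFactorial_neg t x] at h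
  linear_combination -h

theorem centralFactorial_second_difference (t : ℕ) (x : R) :
    centralFactorial (t + 1) (x + 1) + centralFactorial (t + 1) (x - 1) -
      2 * centralFactorial (t + 1) x = (2 * t + 1) * (2 * t + 2) * centralFactorial t x := by
  induction t with
  | zero =>
    simp only [centralFactorial_succ, centralFactorial_zero]
    push_cast
    ring
  | succ t ih =>
    have hadd := mul_centralFactorial_add_one t x
    have hsub := mul_centralFactorial_sub_one t x
    have hsucc := centralFactorial_succ t x
    rw [centralFactorial_succ (t + 1) (x + 1), centralFactorial_succ (t + 1) (x - 1),
      centralFactorial_succ (t + 1) x]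
    push_cast
    linear_combination (x ^ 2 + 1 - (t + 1) ^ 2) * ih + 2 * hadd - 2 * hsub -
      (4 * t ^ 2 + 14 * t + 10) * hsucc

/-- For an integer `n`, the coefficient of `X^t` in the Chebyshev polynomial `Tₙ(1 - X/2)`, as a
polynomial in `n`. -/
def chebyshevCoeff (t : ℕ) (x : ℂ) : ℂ := (-1) ^ t / ((2 * t).factorial : ℂ) * centralFactorial t x

theorem chebyshevCoeff_zero (x : ℂ) : chebyshevCoeff 0 x = 1 := by
  simp [chebyshevCoeff, centralFactorial_zero]

theorem chebyshevCoeff_succ_zero (t : ℕ) : chebyshevCoeff (t + 1) 0 = 0 := by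
  simp [chebyshevCoeff, centralFactorial, prod_range_succ']

theorem chebyshevCoeff_second_difference (t : ℕ) (x : ℂ) :
    chebyshevCoeff (t + 1) (x + 1) + chebyshevCoeff (t + 1) (x - 1) - 2 * chebyshevCoeff (t + 1) x =
      -chebyshevCoeff t x := by
  have hfact : ((2 * (t + 1)).factorial : ℂ) =
      (2 * t + 1) * (2 * t + 2) * (2 * t).factorial := by
    rw [show 2 * (t + 1) = 2 * t + 1 + 1 by ring, Nat.factorial_succ, Nat.factorial_succ]
    push_cast
    ring
  have h0 : ((2 * t).factorial : ℂ) ≠ 0 := mod_cast Nat.factorial_ne_zero _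
  have h1 : (2 * t + 1 : ℂ) ≠ 0 := mod_cast (2 * t).succ_ne_zero
  calc _ = (-1) ^ (t + 1) / ((2 * (t + 1)).factorial : ℂ) *
        (centralFactorial (t + 1) (x + 1) + centralFactorial (t + 1) (x - 1) -
          2 * centralFactorial (t + 1) x) := by
        simp only [chebyshevCoeff]
        ring
    _ = (-1) ^ (t + 1) / ((2 * t).factorial : ℂ) * centralFactorial t x := by
        rw [centralFactorial_second_difference, hfact]
        field_simp
    _ = -chebyshevCoeff t x := by
        rw [chebyshevCoeff, pow_succ]
        ring

end CentralFactorial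

section CentralQBinomial

variable {K : Type*} [Field K] {x : K}

/-- The `q`-Pochhammer symbol `(x; x)_m`. -/
def qPochhammer (x : K) (m : ℕ) : K := ∏ i ∈ range m, (1 - x ^ (i + 1))

/-- The inverse `1 / (x; x)_m`, extended by `0` to negative `m`. -/
def qPochhammerInv (x : K) (m : ℤ) : K := if m < 0 then 0 else (qPochhammer x m.toNat)⁻¹

/-- The central Gaussian binomial coefficient `[2N choose N + n]` with base `x`, equal to `0` for
`N < |n|`. -/
def centralQBinom (x : K) (N : ℕ) (n : ℤ) : K :=
  qPochhammer x (2 * N) * qPochhammerInv x (N + n) * qPochhammerInv x (N - n)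

theorem qPochhammerInv_of_neg {m : ℤ} (hm : m < 0) : qPochhammerInv x m = 0 := if_pos hm

theorem qPochhammerInv_natCast (m : ℕ) : qPochhammerInv x m = (qPochhammer x m)⁻¹ := by
  rw [qPochhammerInv, if_neg (Int.natCast_nonneg m).not_gt, Int.toNat_natCast]

theorem one_sub_pow_ne_zero (hx : ¬IsOfFinOrder x) {k : ℕ} (hk : 0 < k) : 1 - x ^ k ≠ 0 :=
  fun h => hx (isOfFinOrder_iff_pow_eq_one.2 ⟨k, hk, (sub_eq_zero.1 h).symm⟩)

theorem qPochhammer_succ (x : K) (m : ℕ) :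
    qPochhammer x (m + 1) = qPochhammer x m * (1 - x ^ (m + 1)) :=
  prod_range_succ _ _

theorem qPochhammerInv_sub_one (hx : ¬IsOfFinOrder x) (m : ℤ) :
    qPochhammerInv x (m - 1) = (1 - x ^ m) * qPochhammerInv x m := by
  rcases lt_trichotomy m 0 with h | rfl | h
  · rw [qPochhammerInv_of_neg h, qPochhammerInv_of_neg (by omega), mul_zero]
  · rw [qPochhammerInv_of_neg (by omega), zpow_zero, sub_self, zero_mul]
  · obtain ⟨k, rfl⟩ := Int.eq_succ_of_zero_lt h
    rw [add_sub_cancel_right, ← Nat.cast_add_one, zpow_natCast, qPochhammerInv_natCast,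
      qPochhammerInv_natCast, qPochhammer_succ, mul_inv, mul_left_comm,
      mul_inv_cancel₀ (one_sub_pow_ne_zero hx k.succ_pos), mul_one]

theorem centralQBinom_of_lt_abs {N : ℕ} {n : ℤ} (h : (N : ℤ) < |n|) : centralQBinom x N n = 0 := by
  rcases lt_abs.1 h with h | h
  · rw [centralQBinom, qPochhammerInv_of_neg (m := N - n) (by omega), mul_zero]
  · rw [centralQBinom, qPochhammerInv_of_neg (m := N + n) (by omega), mul_zero, zero_mul]

theorem centralQBinom_zero_zero (x : K) : centralQBinom x 0 0 = 1 := by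
  simp [centralQBinom, qPochhammer, qPochhammerInv]

theorem centralQBinom_succ (hx : ¬IsOfFinOrder x) (h0 : x ≠ 0) (N : ℕ) (n : ℤ) :
    centralQBinom x (N + 1) n = (1 + x ^ (2 * N + 1)) * centralQBinom x N n +
      x ^ (N + 1 - n : ℤ) * centralQBinom x N (n - 1) +
      x ^ (N + 1 + n : ℤ) * centralQBinom x N (n + 1) := by
  have lower_twice (m : ℤ) : qPochhammerInv x (m - 1 - 1) =
      (1 - x ^ m / x) * ((1 - x ^ m) * qPochhammerInv x m) := by
    rw [qPochhammerInv_sub_one hx, qPochhammerInv_sub_one hx, zpow_sub_one₀ h0, div_eq_mul_inv]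
  have hprod : x ^ (2 * N + 2) = x ^ (N + 1 + n : ℤ) * x ^ (N + 1 - n : ℤ) := by
    rw [← zpow_add₀ h0, ← zpow_natCast]
    congr 1
    push_cast
    ring
  have hprod' : x ^ (2 * N + 1) = x ^ (N + 1 + n : ℤ) * x ^ (N + 1 - n : ℤ) / x := by
    rw [← hprod, pow_succ x (2 * N + 1), mul_div_cancel_right₀ _ h0]
  have hpoch : qPochhammer x (2 * (N + 1)) =
      qPochhammer x (2 * N) * (1 - x ^ (2 * N + 1)) * (1 - x ^ (2 * N + 2)) := by
    rw [mul_add_one, qPochhammer_succ, qPochhammer_succ]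
  simp only [centralQBinom]
  rw [hpoch, hprod, hprod', Nat.cast_succ,
    show (N + n : ℤ) = N + 1 + n - 1 by ring, show (N - n : ℤ) = N + 1 - n - 1 by ring,
    show (N + (n - 1) : ℤ) = N + 1 + n - 1 - 1 by ring,
    show (N - (n - 1) : ℤ) = N + 1 - n by ring, show (N + (n + 1) : ℤ) = N + 1 + n by ring,
    show (N - (n + 1) : ℤ) = N + 1 - n - 1 - 1 by ring, lower_twice, lower_twice,
    qPochhammerInv_sub_one hx, qPochhammerInv_sub_one hx]
  ring

end CentralQBinomial

section FiniteTheta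

variable {q : ℂ}

/-- The term of index `n` of the finite theta function: the coefficient of `zⁿ` in
`∏_{s < N} (1 - z q^(2s+1)) (1 - z⁻¹ q^(2s+1))`. -/
def finiteTheta (q : ℂ) (N : ℕ) (n : ℤ) : ℂ :=
  (-1) ^ n * q ^ n.natAbs ^ 2 * centralQBinom (q ^ 2) N n

theorem not_isOfFinOrder_of_norm_lt_one (hq : ‖q‖ < 1) : ¬IsOfFinOrder q :=
  fun h => hq.ne h.norm_eq_one

theorem finiteTheta_of_lt_abs {N : ℕ} {n : ℤ} (h : (N : ℤ) < |n|) : finiteTheta q N n = 0 := by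
  rw [finiteTheta, centralQBinom_of_lt_abs h, mul_zero]

theorem finiteTheta_zero_zero (q : ℂ) : finiteTheta q 0 0 = 1 := by
  simp [finiteTheta, centralQBinom_zero_zero]

theorem finiteTheta_succ (hq : ‖q‖ < 1) (h0 : q ≠ 0) (N : ℕ) (n : ℤ) :
    finiteTheta q (N + 1) n = (1 + (q ^ (2 * N + 1)) ^ 2) * finiteTheta q N n -
      q ^ (2 * N + 1) * (finiteTheta q N (n - 1) + finiteTheta q N (n + 1)) := by
  have hpow (m : ℤ) : q ^ m.natAbs ^ 2 = q ^ m ^ 2 := by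
    rw [← zpow_natCast, Nat.cast_pow, Int.natAbs_sq]
  have hsq (m : ℤ) : (q ^ 2) ^ m = q ^ (2 * m) := by rw [zpow_mul, zpow_ofNat]
  have hsub : q ^ (2 * N + 1) * q ^ (n - 1).natAbs ^ 2 =
      (q ^ 2) ^ (N + 1 - n : ℤ) * q ^ n.natAbs ^ 2 := by
    rw [hpow, hpow, hsq, ← zpow_natCast, ← zpow_add₀ h0, ← zpow_add₀ h0]
    congr 1
    push_cast
    ring
  have hadd : q ^ (2 * N + 1) * q ^ (n + 1).natAbs ^ 2 =
      (q ^ 2) ^ (N + 1 + n : ℤ) * q ^ n.natAbs ^ 2 := by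
    rw [hpow, hpow, hsq, ← zpow_natCast, ← zpow_add₀ h0, ← zpow_add₀ h0]
    congr 1
    push_cast
    ring
  simp only [finiteTheta]
  rw [centralQBinom_succ (not_isOfFinOrder_of_norm_lt_one (norm_sq_lt_one hq))
    (pow_ne_zero 2 h0), zpow_sub_one₀ (by norm_num), zpow_add_one₀ (by norm_num)]
  linear_combination -(-1) ^ n * centralQBinom (q ^ 2) N (n - 1) * hsub -
    (-1) ^ n * centralQBinom (q ^ 2) N (n + 1) * hadd

theorem summable_finiteTheta_mul (q : ℂ) (N : ℕ) (f : ℤ → ℂ) :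
    Summable fun n => finiteTheta q N n * f n := by
  refine summable_of_hasFiniteSupport ((Set.finite_Icc (-(N : ℤ)) N).subset fun n hn => ?_)
  rw [Set.mem_Icc, ← abs_le]
  by_contra! h
  exact hn (mul_eq_zero_of_left (finiteTheta_of_lt_abs h) _)

theorem tsum_finiteTheta_succ_mul (hq : ‖q‖ < 1) (h0 : q ≠ 0) (N : ℕ) (f : ℤ → ℂ) :
    ∑' n, finiteTheta q (N + 1) n * f n =
      (1 - q ^ (2 * N + 1)) ^ 2 * ∑' n, finiteTheta q N n * f n -
        q ^ (2 * N + 1) * ∑' n, finiteTheta q N n * (f (n + 1) + f (n - 1) - 2 * f n) := by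
  have hs := summable_finiteTheta_mul q N
  have hleft : HasSum (fun n => finiteTheta q N (n - 1) * f n)
      (∑' n, finiteTheta q N n * f (n + 1)) := by
    rw [← (Equiv.addRight (1 : ℤ)).hasSum_iff]
    simpa [Function.comp_def] using (hs fun n => f (n + 1)).hasSum
  have hright : HasSum (fun n => finiteTheta q N (n + 1) * f n)
      (∑' n, finiteTheta q N n * f (n - 1)) := by
    rw [← (Equiv.subRight (1 : ℤ)).hasSum_iff]
    simpa [Function.comp_def] using (hs fun n => f (n - 1)).hasSum
  have hdiff : ∑' n, finiteTheta q N n * (f (n + 1) + f (n - 1) - 2 * f n) =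
      ∑' n, finiteTheta q N n * f (n + 1) + ∑' n, finiteTheta q N n * f (n - 1) -
        2 * ∑' n, finiteTheta q N n * f n := by
    rw [← (hs fun n => f (n + 1)).tsum_add (hs fun n => f (n - 1)), ← tsum_mul_left,
      ← ((hs fun n => f (n + 1)).add (hs fun n => f (n - 1))).tsum_sub ((hs f).mul_left 2)]
    exact tsum_congr fun n => by ring
  have hsucc : HasSum (fun n => finiteTheta q (N + 1) n * f n)
      ((1 + (q ^ (2 * N + 1)) ^ 2) * ∑' n, finiteTheta q N n * f n - q ^ (2 * N + 1) *
        (∑' n, finiteTheta q N n * f (n + 1) + ∑' n, finiteTheta q N n * f (n - 1))) := by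
    refine (((hs f).hasSum.mul_left _).sub ((hleft.add hright).mul_left _)).congr_fun fun n => ?_
    rw [finiteTheta_succ hq h0]
    ring
  rw [hsucc.tsum_eq, hdiff]
  ring

end FiniteTheta

section ElementarySymmetric

variable {R : Type*} [CommSemiring R]

theorem esymm_cons_succ (a : R) (s : Multiset R) (t : ℕ) :
    (a ::ₘ s).esymm (t + 1) = s.esymm (t + 1) + a * s.esymm t := by
  simp only [Multiset.esymm, Multiset.powersetCard_cons, Multiset.map_add, Multiset.sum_add,
    Multiset.map_map, Function.comp_def, Multiset.prod_cons, Multiset.sum_map_mul_left]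

/-- The elementary symmetric polynomial of degree `t` in the values `u 0, …, u (N - 1)`. -/
def esymmRange (u : ℕ → R) (N t : ℕ) : R := ((Multiset.range N).map u).esymm t

theorem esymmRange_eq_sum (u : ℕ → R) (N t : ℕ) :
    esymmRange u N t = ∑ s ∈ powersetCard t (range N), ∏ i ∈ s, u i :=
  esymm_map_val u (range N) t

theorem esymmRange_zero_right (u : ℕ → R) (N : ℕ) : esymmRange u N 0 = 1 := by
  simp [esymmRange_eq_sum]

theorem esymmRange_zero_succ (u : ℕ → R) (t : ℕ) : esymmRange u 0 (t + 1) = 0 := by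
  rw [esymmRange_eq_sum, powersetCard_eq_empty.2 (by simp), sum_empty]

theorem esymmRange_succ_succ (u : ℕ → R) (N t : ℕ) :
    esymmRange u (N + 1) (t + 1) = esymmRange u N (t + 1) + u N * esymmRange u N t := by
  rw [esymmRange, Multiset.range_succ, Multiset.map_cons, esymm_cons_succ, esymmRange, esymmRange]

theorem esymmRange_self (u : ℕ → R) (N : ℕ) : esymmRange u N N = ∏ i ∈ range N, u i := by
  have h := powersetCard_self (range N)
  rw [card_range] at h
  rw [esymmRange_eq_sum, h, sum_singleton]

theorem prod_sub_eq_sum_esymmRange {R : Type*} [CommRing R] (u : ℕ → R) (t : ℕ) (y : R) :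
    ∏ j ∈ range t, (y - u j) =
      ∑ k ∈ range (t + 1), (-1) ^ (t - k) * esymmRange u t (t - k) * y ^ k := by
  have h := congrArg (Polynomial.eval y)
    (Multiset.prod_X_sub_X_eq_sum_esymm ((Multiset.range t).map u))
  rw [Multiset.card_map, Multiset.card_range, Multiset.map_map, Polynomial.eval_multiset_prod,
    Multiset.map_map, Polynomial.eval_finsetSum, ← sum_range_reflect] at h
  simp only [Function.comp_def, Polynomial.eval_sub, Polynomial.eval_X, Polynomial.eval_C,
    Polynomial.eval_mul, Polynomial.eval_pow, Polynomial.eval_neg, Polynomial.eval_one] at h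
  refine h.trans (sum_congr rfl fun k hk => ?_)
  rw [show t + 1 - 1 - k = t - k by omega, Nat.sub_sub_self (mem_range_succ_iff.1 hk), ← mul_assoc]
  rfl

theorem natCast_esymmSquares {R : Type*} [CommSemiring R] (t j : ℕ) :
    (esymmSquares t j : R) = esymmRange (fun i => (i : R) ^ 2) t j := by
  rw [show esymmSquares t j = esymmRange (fun i => i ^ 2) t j from rfl, esymmRange_eq_sum,
    esymmRange_eq_sum]
  push_cast
  rfl

theorem esymmSquares_succ_self (t : ℕ) : esymmSquares (t + 1) (t + 1) = 0 :=
  (esymmRange_self (fun i => i ^ 2) (t + 1)).trans (prod_eq_zero (mem_range.2 t.succ_pos) rfl)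

theorem chebyshevCoeff_eq_sum (t : ℕ) (x : ℂ) :
    chebyshevCoeff t x = ∑ k ∈ range (t + 1),
      (-1) ^ k * ((esymmSquares t (t - k) : ℂ) / ((2 * t).factorial : ℂ)) * x ^ (2 * k) := by
  rw [chebyshevCoeff, centralFactorial, prod_sub_eq_sum_esymmRange (fun i => (i : ℂ) ^ 2), mul_sum]
  refine sum_congr rfl fun k hk => ?_
  have hsign : (-1 : ℂ) ^ t * (-1) ^ (t - k) = (-1) ^ k := by
    rw [← pow_add, neg_one_pow_congr]
    have := mem_range_succ_iff.1 hk
    grind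
  rw [natCast_esymmSquares, ← hsign]
  ring

end ElementarySymmetric

section FiniteMacMahon

variable {q : ℂ}

/-- The weight `q^(2s+1) / (1 - q^(2s+1))²`, in which the odd parts are indexed from `0`. -/
def oddTerm (q : ℂ) (s : ℕ) : ℂ := q ^ (2 * s + 1) / (1 - q ^ (2 * s + 1)) ^ 2

theorem oddTerm_mul (hq : ‖q‖ < 1) (s : ℕ) :
    oddTerm q s * (1 - q ^ (2 * s + 1)) ^ 2 = q ^ (2 * s + 1) :=
  div_mul_cancel₀ _
    (pow_ne_zero 2 (one_sub_pow_ne_zero (not_isOfFinOrder_of_norm_lt_one hq) (by omega)))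

theorem esymmRange_oddTerm_mul_prod (hq : ‖q‖ < 1) (h0 : q ≠ 0) (N t : ℕ) :
    esymmRange (oddTerm q) N t * ∏ s ∈ range N, (1 - q ^ (2 * s + 1)) ^ 2 =
      ∑' n : ℤ, finiteTheta q N n * chebyshevCoeff t n := by
  induction N generalizing t with
  | zero =>
    rw [tsum_eq_single 0 fun n hn => by
      rw [finiteTheta_of_lt_abs (by simpa using hn), zero_mul], finiteTheta_zero_zero]
    rcases t with - | t
    · simp [esymmRange_zero_right, chebyshevCoeff_zero]
    · simp [esymmRange_zero_succ, chebyshevCoeff_succ_zero]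
  | succ N ih =>
    rw [tsum_finiteTheta_succ_mul hq h0, ← ih, prod_range_succ]
    rcases t with - | t
    · simp only [esymmRange_zero_right, chebyshevCoeff_zero]
      norm_num
      ring
    · have hdiff (n : ℤ) : chebyshevCoeff (t + 1) ↑(n + 1) + chebyshevCoeff (t + 1) ↑(n - 1) -
          2 * chebyshevCoeff (t + 1) n = -chebyshevCoeff t n := by
        rw [Int.cast_add, Int.cast_sub, Int.cast_one, chebyshevCoeff_second_difference]
      simp only [hdiff, mul_neg, tsum_neg, ← ih, esymmRange_succ_succ]
      linear_combination esymmRange (oddTerm q) N t *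
        (∏ s ∈ range N, (1 - q ^ (2 * s + 1)) ^ 2) * oddTerm_mul hq N

end FiniteMacMahon

section Limit

variable {q x : ℂ}

theorem exists_tendsto_qPochhammer (hx : ‖x‖ < 1) :
    ∃ L ≠ 0, Tendsto (qPochhammer x) atTop (𝓝 L) := by
  have hs : Summable fun i : ℕ => ‖-x ^ (i + 1)‖ := by
    simpa only [norm_neg, norm_pow] using
      (summable_nat_add_iff 1).2 (summable_geometric_of_lt_one (norm_nonneg x) hx)
  refine ⟨∏' i : ℕ, (1 + -x ^ (i + 1)), tprod_one_add_ne_zero_of_summable (fun i => ?_) hs, ?_⟩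
  · rw [← sub_eq_add_neg]
    exact one_sub_pow_ne_zero (not_isOfFinOrder_of_norm_lt_one hx) i.succ_pos
  · simpa only [← sub_eq_add_neg] using!
      (multipliable_one_add_of_summable hs).hasProd.tendsto_prod_nat

theorem tendsto_qPochhammerInv {L : ℂ} (hL0 : L ≠ 0) (hL : Tendsto (qPochhammer x) atTop (𝓝 L)) :
    Tendsto (qPochhammerInv x) atTop (𝓝 L⁻¹) := by
  have htoNat : Tendsto Int.toNat atTop atTop := tendsto_atTop.2 fun b => by
    filter_upwards [eventually_ge_atTop (b : ℤ)] with m hm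
    omega
  refine ((hL.inv₀ hL0).comp htoNat).congr' ?_
  filter_upwards [eventually_ge_atTop 0] with m hm
  rw [qPochhammerInv, if_neg hm.not_gt, Function.comp_apply]

theorem exists_tendsto_centralQBinom (hx : ‖x‖ < 1) :
    ∃ κ ≠ 0, ∀ n, Tendsto (fun N => centralQBinom x N n) atTop (𝓝 κ) := by
  obtain ⟨L, hL0, hL⟩ := exists_tendsto_qPochhammer hx
  have hinv (m : ℤ) : Tendsto (fun N : ℕ => qPochhammerInv x (N + m)) atTop (𝓝 L⁻¹) :=
    (tendsto_qPochhammerInv hL0 hL).comp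
      (tendsto_atTop_add_const_right _ m tendsto_natCast_atTop_atTop)
  have hmul : Tendsto (fun N : ℕ => qPochhammer x (2 * N)) atTop (𝓝 L) :=
    hL.comp (tendsto_id.const_mul_atTop' two_pos)
  refine ⟨L * L⁻¹ * L⁻¹, by simp [hL0], fun n => ?_⟩
  simpa only [centralQBinom, sub_eq_add_neg] using (hmul.mul (hinv n)).mul (hinv (-n))

theorem exists_norm_centralQBinom_le (hx : ‖x‖ < 1) :
    ∃ B, ∀ N n, ‖centralQBinom x N n‖ ≤ B := by
  obtain ⟨L, hL0, hL⟩ := exists_tendsto_qPochhammer hx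
  obtain ⟨A, hA⟩ := hL.norm.bddAbove_range
  obtain ⟨A', hA'⟩ := (hL.inv₀ hL0).norm.bddAbove_range
  have hpoch (m : ℕ) : ‖qPochhammer x m‖ ≤ A := hA ⟨m, rfl⟩
  have hinv (m : ℤ) : ‖qPochhammerInv x m‖ ≤ A' := by
    rw [qPochhammerInv]
    split_ifs
    · exact norm_zero.trans_le ((norm_nonneg _).trans (hA' ⟨0, rfl⟩))
    · exact hA' ⟨m.toNat, rfl⟩
  refine ⟨A * A' * A', fun N n => ?_⟩
  rw [centralQBinom, norm_mul, norm_mul]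
  have hA0 : 0 ≤ A := (norm_nonneg _).trans (hpoch 0)
  have hA0' : 0 ≤ A' := (norm_nonneg _).trans (hinv 0)
  gcongr
  exacts [hpoch _, hinv _, hinv _]

theorem exists_tendsto_tsum_finiteTheta_mul (hq : ‖q‖ < 1) :
    ∃ κ ≠ 0, ∀ f : ℤ → ℂ, Summable (fun n => (-1) ^ n * q ^ n.natAbs ^ 2 * f n) →
      Tendsto (fun N => ∑' n, finiteTheta q N n * f n) atTop
        (𝓝 (κ * ∑' n : ℤ, (-1) ^ n * q ^ n.natAbs ^ 2 * f n)) := by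
  obtain ⟨κ, hκ, hlim⟩ := exists_tendsto_centralQBinom (norm_sq_lt_one hq)
  obtain ⟨B, hB⟩ := exists_norm_centralQBinom_le (norm_sq_lt_one hq)
  refine ⟨κ, hκ, fun f hf => ?_⟩
  have hterm (N : ℕ) (n : ℤ) : finiteTheta q N n * f n =
      centralQBinom (q ^ 2) N n * ((-1) ^ n * q ^ n.natAbs ^ 2 * f n) := by
    rw [finiteTheta]
    ring
  simp only [hterm, ← tsum_mul_left]
  refine tendsto_tsum_of_dominated_convergence (hf.norm.mul_left B)
    (fun n => (hlim n).mul_const _) (Eventually.of_forall fun N n => ?_)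
  rw [norm_mul]
  gcongr
  exact hB N n

theorem summable_norm_pow_div_one_sub_sq (hq : ‖q‖ < 1) {e : ℕ → ℕ} (he : ∀ s, s ≤ e s) :
    Summable fun s => ‖q ^ e s / (1 - q ^ e s) ^ 2‖ := by
  have hpow : Tendsto (fun s : ℕ => q ^ e s) atTop (𝓝 0) :=
    (tendsto_pow_atTop_nhds_zero_of_norm_lt_one hq).comp (tendsto_atTop_mono he tendsto_id)
  have hinv : Tendsto (fun s : ℕ => ‖((1 - q ^ e s) ^ 2)⁻¹‖) atTop (𝓝 1) := by
    simpa using ((((tendsto_const_nhds (x := (1 : ℂ))).sub hpow).pow 2).inv₀ (by simp)).norm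
  obtain ⟨B, hB⟩ := hinv.bddAbove_range
  refine ((summable_geometric_of_lt_one (norm_nonneg q) hq).mul_left B).of_nonneg_of_le
    (fun _ => norm_nonneg _) fun s => ?_
  have hBs := hB ⟨s, rfl⟩
  rw [div_eq_mul_inv, norm_mul, mul_comm, norm_pow]
  exact mul_le_mul hBs (pow_le_pow_of_le_one (norm_nonneg q) hq.le (he s)) (by positivity)
    ((norm_nonneg _).trans hBs)

theorem summable_norm_oddTerm (hq : ‖q‖ < 1) : Summable fun s => ‖oddTerm q s‖ :=
  summable_norm_pow_div_one_sub_sq hq fun s => by omega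

theorem tendsto_esymmRange {R : Type*} [NormedCommRing R] [NormOneClass R] [CompleteSpace R]
    {u : ℕ → R} (hu : Summable fun s => ‖u s‖) (t : ℕ) :
    Tendsto (fun N => esymmRange u N t) atTop
      (𝓝 (∑' S : Set.powersetCard ℕ t, ∏ i ∈ (S : Finset ℕ), u i)) := by
  have hs : Summable ((Set.powersetCard ℕ t).indicator fun S => ∏ i ∈ S, u i) :=
    (summable_finsetProd_of_summable_norm hu).indicator _
  have hlim := hs.hasSum.comp (tendsto_finset_powerset_atTop_atTop.comp tendsto_finset_range)
  rw [← _root_.tsum_subtype] at hlim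
  refine hlim.congr fun N => ?_
  classical
  rw [esymmRange_eq_sum, powersetCard_eq_filter, sum_filter]
  exact sum_congr rfl fun S _ => by simp only [Set.indicator_apply, Set.powersetCard.mem_iff]

end Limit

section MacMahon

variable {q : ℂ}

/-- Strictly increasing families of `t` positive integers as `t`-element sets of natural numbers,
each entry `s` being lowered to `s - 1`. -/
def strictChainEquiv (t : ℕ) : (Fin t ↪o ℕ+) ≃ Set.powersetCard ℕ t :=
  (OrderIso.orderEmbeddingCongr (OrderIso.refl _) OrderIso.pnatIsoNat).trans
    Set.powersetCard.ofFinEmbEquiv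

theorem term_eq_prod_strictChainEquiv (t : ℕ) (q : ℂ) (s : Fin t ↪o ℕ+) :
    term t q s = ∏ i ∈ (strictChainEquiv t s : Finset ℕ), oddTerm q i := by
  have hmap : (strictChainEquiv t s : Finset ℕ) =
      univ.map (s.toEmbedding.trans OrderIso.pnatIsoNat.toEquiv.toEmbedding) := rfl
  rw [hmap, prod_map, term]
  refine prod_congr rfl fun i _ => ?_
  have hodd : 2 * (s i : ℕ) - 1 = 2 * (s i).natPred + 1 := by
    have := (s i).natPred_add_one
    omega
  rw [hodd]
  rfl

theorem summable_term (t : ℕ) (hq : ‖q‖ < 1) : Summable (term t q) := by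
  have h := ((summable_finsetProd_of_summable_norm (summable_norm_oddTerm hq)).subtype
    (Set.powersetCard ℕ t)).comp_injective (strictChainEquiv t).injective
  exact h.congr fun s => (term_eq_prod_strictChainEquiv t q s).symm

theorem C_eq_tsum_powersetCard (t : ℕ) (q : ℂ) :
    C t q = ∑' S : Set.powersetCard ℕ t, ∏ i ∈ (S : Finset ℕ), oddTerm q i := by
  rw [C, ← (strictChainEquiv t).tsum_eq]
  exact tsum_congr (term_eq_prod_strictChainEquiv t q)

theorem tendsto_esymmRange_oddTerm (t : ℕ) (hq : ‖q‖ < 1) :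
    Tendsto (fun N => esymmRange (oddTerm q) N t) atTop (𝓝 (C t q)) :=
  C_eq_tsum_powersetCard t q ▸ tendsto_esymmRange (summable_norm_oddTerm hq) t

theorem tsum_oddTerm (hq : ‖q‖ < 1) : ∑' s, oddTerm q s = C 1 q := by
  refine tendsto_nhds_unique (summable_norm_oddTerm hq).of_norm.hasSum.tendsto_sum_nat
    ((tendsto_esymmRange_oddTerm 1 hq).congr fun N => ?_)
  simp [esymmRange_eq_sum, powersetCard_one]

theorem hasSum_chebyshevCoeff (t : ℕ) (hq : ‖q‖ < 1) :
    HasSum (fun n : ℤ => (-1) ^ n * q ^ n.natAbs ^ 2 * chebyshevCoeff t n)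
      (∑ k ∈ range (t + 1), (-1) ^ k * ((esymmSquares t (t - k) : ℂ) / ((2 * t).factorial : ℂ)) *
        theta4Moment k q) := by
  refine (hasSum_sum fun k _ =>
    ((summableOnDisc_theta4Moment k).summable hq).hasSum.mul_left _).congr_fun fun n => ?_
  rw [chebyshevCoeff_eq_sum, mul_sum]
  exact sum_congr rfl fun k _ => by ring

theorem C_apply_zero (t : ℕ) : C t 0 = chebyshevCoeff t 0 := by
  rcases t with - | t
  · rw [chebyshevCoeff_zero]
    simpa [esymmRange_zero_right, tendsto_const_nhds_iff, eq_comm] using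
      tendsto_esymmRange_oddTerm 0 (q := 0) (by simp)
  · have hterm (s : Fin (t + 1) ↪o ℕ+) : term (t + 1) 0 s = 0 := by
      refine prod_eq_zero (mem_univ 0) ?_
      have := (s 0).pos
      rw [zero_pow (by omega), zero_div]
    simp [C, hterm, chebyshevCoeff_succ_zero]

theorem C_mul_theta4_eq_tsum (t : ℕ) (hq : ‖q‖ < 1) :
    C t q * theta4 q = ∑' n : ℤ, (-1) ^ n * q ^ n.natAbs ^ 2 * chebyshevCoeff t n := by
  rcases eq_or_ne q 0 with rfl | h0
  · rw [tsum_eq_single 0 fun n hn => by simp [hn], theta4_zero, C_apply_zero]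
    simp
  obtain ⟨κ, hκ, hlim⟩ := exists_tendsto_tsum_finiteTheta_mul hq
  have hlim' (t : ℕ) := hlim _ (hasSum_chebyshevCoeff t hq).summable
  simp only [← esymmRange_oddTerm_mul_prod hq h0] at hlim'
  have hprod : Tendsto (fun N => ∏ s ∈ range N, (1 - q ^ (2 * s + 1)) ^ 2) atTop
      (𝓝 (κ * theta4 q)) := by
    simpa only [esymmRange_zero_right, chebyshevCoeff_zero, one_mul, mul_one, theta4_eq_tsum]
      using hlim' 0
  have h := tendsto_nhds_unique ((tendsto_esymmRange_oddTerm t hq).mul hprod) (hlim' t)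
  exact mul_left_cancel₀ hκ (by rw [← h, mul_left_comm])

theorem C_mul_theta4 {t : ℕ} (ht : 1 ≤ t) (hq : ‖q‖ < 1) :
    C t q * theta4 q = ∑ k ∈ Icc 1 t,
      (-1) ^ k * ((esymmSquares t (t - k) : ℂ) / ((2 * t).factorial : ℂ)) * theta4Moment k q := by
  obtain ⟨t, rfl⟩ := Nat.exists_eq_add_of_le' ht
  rw [C_mul_theta4_eq_tsum _ hq, (hasSum_chebyshevCoeff _ hq).tsum_eq, range_eq_Ico,
    sum_eq_sum_Ico_succ_bot (Nat.succ_pos _), Nat.sub_zero, esymmSquares_succ_self]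
  simp only [Nat.cast_zero, zero_div, mul_zero, zero_mul, zero_add]
  rfl

end MacMahon

section Eisenstein

variable {q : ℂ}

/-- The Lambert series `∑ σ₁(n) qⁿ`, so that `E₂ = 1 - 24 sigmaSeries`. -/
def sigmaSeries (q : ℂ) : ℂ :=
  ∑' n : ℕ+, (ArithmeticFunction.sigma 1 (n : ℕ) : ℂ) * q ^ (n : ℕ)

theorem eisenstein_one (q : ℂ) : eisenstein 1 q = 1 - 24 * sigmaSeries q := by
  rw [eisenstein, sigmaSeries, mul_one, bernoulli_two]
  norm_num

theorem sigmaSeries_zero : sigmaSeries 0 = 0 := by simp [sigmaSeries]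

theorem differentiableOn_sigmaSeries : DifferentiableOn ℂ sigmaSeries (Metric.ball 0 1) := by
  refine SummableOnDisc.differentiableOn_tsum fun r hr hr1 => ?_
  have hsq := (summable_pow_mul_geometric_of_norm_lt_one 2 (r := r)
    (by rwa [Real.norm_of_nonneg hr])).comp_injective PNat.coe_injective
  refine hsq.of_nonneg_of_le (fun n => by positivity) fun n => ?_
  simp only [Complex.norm_natCast, Function.comp_apply]
  gcongr
  exact_mod_cast ArithmeticFunction.sigma_le_pow_succ 1 (n : ℕ)

theorem sigmaSeries_eq_tsum (hq : ‖q‖ < 1) :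
    sigmaSeries q = ∑' n : ℕ, q ^ (n + 1) / (1 - q ^ (n + 1)) ^ 2 := by
  rw [sigmaSeries, ← tsum_prod_pow_eq_tsum_sigma 1 hq,
    tsum_pnat_eq_tsum_succ (f := fun d => ∑' c : ℕ+, (c : ℂ) ^ 1 * q ^ (d * c : ℕ))]
  refine tsum_congr fun d => ?_
  have hd : ‖q ^ (d + 1)‖ < 1 := by
    rw [norm_pow]
    exact pow_lt_one₀ (norm_nonneg q) hq d.succ_ne_zero
  rw [← tsum_coe_mul_geometric_of_norm_lt_one hd, ← tsum_pnat_eq_tsum_of_eq_zero (by simp)]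
  simp only [pow_mul, pow_one]

theorem sigmaSeries_sub_sq (hq : ‖q‖ < 1) :
    sigmaSeries q - sigmaSeries (q ^ 2) = ∑' s, oddTerm q s := by
  have heven := (summable_norm_pow_div_one_sub_sq hq (e := fun s => 2 * s + 1 + 1)
    fun s => by omega).of_norm
  rw [sigmaSeries_eq_tsum hq, sigmaSeries_eq_tsum (norm_sq_lt_one hq), sub_eq_iff_eq_add,
    ← tsum_even_add_odd (f := fun n => q ^ (n + 1) / (1 - q ^ (n + 1)) ^ 2)
      (summable_norm_oddTerm hq).of_norm heven]
  congr 1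
  refine tsum_congr fun k => ?_
  rw [← pow_mul]
  rfl

theorem logD4_eq (hq : ‖q‖ < 1) : logD4 q = -2 * (sigmaSeries q - sigmaSeries (q ^ 2)) := by
  have hmoment : logD4 q * theta4 q = theta4Moment 1 q :=
    (hasEulerDerivAt_theta4 hq).unique ((hasEulerDerivAt_theta4Moment 0 hq).congr_of_eventuallyEq
      (.of_forall fun w => (theta4Moment_zero w).symm))
  have hC : C 1 q * theta4 q = -(1 / 2) * theta4Moment 1 q := by
    simpa [esymmSquares, Multiset.esymm] using C_mul_theta4 le_rfl hq
  rw [sigmaSeries_sub_sq hq, tsum_oddTerm hq]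
  refine mul_right_cancel₀ (theta4_ne_zero hq) ?_
  linear_combination hmoment + 2 * hC

theorem eisenstein_eq (hq : ‖q‖ < 1) :
    eisenstein 1 q = 24 * logD4 q + theta2 q ^ 4 + theta3 q ^ 4 := by
  have hd : DifferentiableAt ℂ
      (fun q => theta2 q ^ 4 + theta3 q ^ 4 + 24 * logD4 q + 24 * sigmaSeries q) 0 := by
    have h0 : ‖(0 : ℂ)‖ < 1 := by simp
    exact ((((hasEulerDerivAt_theta2_pow_four h0).add
      (hasEulerDerivAt_theta3_pow_four h0)).differentiableAt.add
      ((differentiableAt_of_norm_lt_one differentiableOn_logD4 h0).const_mul 24)).add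
      ((differentiableAt_of_norm_lt_one differentiableOn_sigmaSeries h0).const_mul 24))
  have invariant (w : ℂ) (hw : ‖w‖ < 1) :
      theta2 w ^ 4 + theta3 w ^ 4 + 24 * logD4 w + 24 * sigmaSeries w =
        theta2 (w ^ 2) ^ 4 + theta3 (w ^ 2) ^ 4 + 24 * logD4 (w ^ 2) +
          24 * sigmaSeries (w ^ 2) := by
    have h3 : theta3 w ^ 4 = (theta3 (w ^ 2) ^ 2 + w * psi (w ^ 2) ^ 2) ^ 2 := by
      rw [← theta3_sq hw]
      ring
    rw [logD4_sq hw, theta2_pow_four (w ^ 2), h3]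
    linear_combination (-1 / 2) * theta2_pow_four_duplication hw + 12 * logD4_eq hw
  have h := eq_apply_zero_of_eq_comp_sq hd invariant hq
  simp only [theta2_zero, theta3_zero, logD4_zero, sigmaSeries_zero] at h
  rw [eisenstein_one]
  linear_combination -h

theorem hasEulerDerivAt_eisenstein (hq : ‖q‖ < 1) :
    HasEulerDerivAt (eisenstein 1) ((eisenstein 1 q ^ 2 - (theta2 q ^ 4) ^ 2 -
      14 * (theta2 q ^ 4 * theta3 q ^ 4) - (theta3 q ^ 4) ^ 2) / 12) q := by
  have hlogD4 := (hasEulerDerivAt_mul_deriv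
    (differentiableAt_of_norm_lt_one differentiableOn_logD4 hq)).congr_deriv (mul_deriv_logD4 hq)
  refine ((((hlogD4.const_mul 24).add (hasEulerDerivAt_theta2_pow_four hq)).add
    (hasEulerDerivAt_theta3_pow_four hq)).congr_of_eventuallyEq
      ((eventually_norm_lt_one hq).mono fun w hw => eisenstein_eq hw)).congr_deriv ?_
  rw [eisenstein_eq hq]
  linear_combination 4 * theta2 q ^ 4 * logD2_sub_logD4 hq +
    4 * theta3 q ^ 4 * logD3_sub_logD4 hq

theorem four_mul_logD2 (hq : ‖q‖ < 1) :
    4 * logD2 q = (eisenstein 1 q + 5 * theta3 q ^ 4 - theta2 q ^ 4) / 6 := by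
  linear_combination 4 * logD2_sub_logD4 hq - eisenstein_eq hq / 6

theorem four_mul_logD3 (hq : ‖q‖ < 1) :
    4 * logD3 q = (eisenstein 1 q + 5 * theta2 q ^ 4 - theta3 q ^ 4) / 6 := by
  linear_combination 4 * logD3_sub_logD4 hq - eisenstein_eq hq / 6

end Eisenstein

section Coefficients

theorem cc_eq_zero {α β γ : ℤ} (h : α < 0 ∨ β < 0 ∨ γ < 0) : cc α β γ = 0 := by
  rw [cc, if_pos h]

theorem cc_zero : cc 0 0 0 = 1 := by simp [cc]

theorem cc_rec (α β γ : ℤ) (h : ¬(α = 0 ∧ β = 0 ∧ γ = 0)) :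
    cc α β γ = (2 * α + 4 * β + 4 * γ - 1) / 24 * cc (α - 1) β γ
      + (20 * γ - 4 * β + 3) / 24 * cc α (β - 1) γ
      + (20 * β - 4 * γ + 3) / 24 * cc α β (γ - 1)
      - 7 * (α + 1) / 6 * cc (α + 1) (β - 1) (γ - 1)
      - (α + 1) / 12 * cc (α + 1) (β - 2) γ
      - (α + 1) / 12 * cc (α + 1) β (γ - 2) := by
  by_cases hneg : α < 0 ∨ β < 0 ∨ γ < 0
  · rw [cc_eq_zero hneg, cc_eq_zero (α := α - 1) (by omega), cc_eq_zero (β := β - 1) (by omega),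
      cc_eq_zero (α := α) (γ := γ - 1) (by omega)]
    -- At `α = -1` the terms with first argument `α + 1 = 0` survive, but carry the factor `α + 1`.
    rcases eq_or_ne α (-1) with rfl | hα
    · norm_num
    · rw [cc_eq_zero (α := α + 1) (β := β - 1) (by omega),
        cc_eq_zero (α := α + 1) (β := β - 2) (by omega),
        cc_eq_zero (α := α + 1) (γ := γ - 2) (by omega)]
      ring
  · rw [cc, if_neg hneg, if_neg h]

theorem cc_comm (α β γ : ℤ) : cc α β γ = cc α γ β := by
  induction h : (α + β + γ).toNat using Nat.strong_induction_on generalizing α β γ with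
  | _ n ih =>
    by_cases hneg : α < 0 ∨ β < 0 ∨ γ < 0
    · rw [cc_eq_zero hneg, cc_eq_zero (by tauto)]
    by_cases hzero : α = 0 ∧ β = 0 ∧ γ = 0
    · rw [hzero.2.1, hzero.2.2]
    rw [cc_rec α β γ hzero, cc_rec α γ β (by tauto),
      ih _ (by omega) (α - 1) β γ rfl, ih _ (by omega) α (β - 1) γ rfl,
      ih _ (by omega) α β (γ - 1) rfl, ih _ (by omega) (α + 1) (β - 1) (γ - 1) rfl,
      ih _ (by omega) (α + 1) (β - 2) γ rfl, ih _ (by omega) (α + 1) β (γ - 2) rfl]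
    ring

/-- The part of total degree `k` of the coefficient family `cc`. The index runs over `ℤ³`, so that
the shifts in the recursion are bijections of the index set. -/
def ccDegree (k : ℕ) (x : ℤ × ℤ × ℤ) : ℂ :=
  if x.1 + x.2.1 + x.2.2 = k then (cc x.1 x.2.1 x.2.2 : ℂ) else 0

/-- The triples of nonnegative integers with sum `k`, which carry `ccDegree k`. -/
def degreeSimplex (k : ℕ) : Finset (ℤ × ℤ × ℤ) :=
  ((antidiagonal k).sigma fun x => antidiagonal x.2).image
    fun z => ((z.1.1 : ℤ), (z.2.1 : ℤ), (z.2.2 : ℤ))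

theorem mem_degreeSimplex {k : ℕ} {x : ℤ × ℤ × ℤ} : x ∈ degreeSimplex k ↔
    0 ≤ x.1 ∧ 0 ≤ x.2.1 ∧ 0 ≤ x.2.2 ∧ x.1 + x.2.1 + x.2.2 = k := by
  simp only [degreeSimplex, mem_image, mem_sigma, HasAntidiagonal.mem_antidiagonal]
  constructor
  · rintro ⟨z, ⟨h, h'⟩, rfl⟩
    dsimp only
    omega
  · rintro ⟨h1, h2, h3, h⟩
    refine ⟨⟨(x.1.toNat, (x.2.1 + x.2.2).toNat), (x.2.1.toNat, x.2.2.toNat)⟩, ?_, ?_⟩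
    · dsimp only
      omega
    · rw [Int.toNat_of_nonneg h1, Int.toNat_of_nonneg h2, Int.toNat_of_nonneg h3]

theorem ccDegree_eq_zero {k : ℕ} {x : ℤ × ℤ × ℤ} (hx : x ∉ degreeSimplex k) :
    ccDegree k x = 0 := by
  rw [mem_degreeSimplex] at hx
  rw [ccDegree]
  split_ifs with h
  · rw [cc_eq_zero (by omega), Rat.cast_zero]
  · rfl

theorem ccDegree_swap (k : ℕ) (x : ℤ × ℤ × ℤ) : ccDegree k (x.1, x.2.swap) = ccDegree k x := by
  rw [ccDegree, ccDegree, Prod.fst_swap, Prod.snd_swap, cc_comm, add_right_comm]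

theorem summable_ccDegree_mul (k : ℕ) (g : ℤ × ℤ × ℤ → ℂ) :
    Summable fun x => ccDegree k x * g x :=
  summable_of_ne_finset_zero (s := degreeSimplex k) fun x hx => by
    rw [ccDegree_eq_zero hx, zero_mul]

theorem tsum_ccDegree_mul (k : ℕ) (g : ℤ × ℤ × ℤ → ℂ) :
    ∑' x, ccDegree k x * g x = ∑ x ∈ degreeSimplex k, ccDegree k x * g x :=
  tsum_eq_sum fun x hx => by rw [ccDegree_eq_zero hx, zero_mul]

theorem hasSum_ccDegree_sub_mul (k : ℕ) (v : ℤ × ℤ × ℤ) (g : ℤ × ℤ × ℤ → ℂ) :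
    HasSum (fun x => ccDegree k (x - v) * g x) (∑' x, ccDegree k x * g (x + v)) := by
  rw [← (Equiv.addRight v).hasSum_iff]
  simpa [Function.comp_def] using (summable_ccDegree_mul k fun x => g (x + v)).hasSum

theorem ccDegree_succ (k : ℕ) (x : ℤ × ℤ × ℤ) : ccDegree (k + 1) x =
    ccDegree k (x - (1, 0, 0)) * ((2 * x.1 + 4 * x.2.1 + 4 * x.2.2 - 1) / 24)
      + ccDegree k (x - (0, 1, 0)) * ((20 * x.2.2 - 4 * x.2.1 + 3) / 24)
      + ccDegree k (x - (0, 0, 1)) * ((20 * x.2.1 - 4 * x.2.2 + 3) / 24)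
      - ccDegree k (x - (-1, 1, 1)) * (7 * (x.1 + 1) / 6)
      - ccDegree k (x - (-1, 2, 0)) * ((x.1 + 1) / 12)
      - ccDegree k (x - (-1, 0, 2)) * ((x.1 + 1) / 12) := by
  obtain ⟨α, β, γ⟩ := x
  simp only [ccDegree, Prod.mk_sub_mk, sub_zero, sub_neg_eq_add, Nat.cast_succ]
  by_cases h : α + β + γ = (k : ℤ) + 1
  · rw [if_pos h, if_pos (by omega), if_pos (by omega), if_pos (by omega), if_pos (by omega),
      if_pos (by omega), if_pos (by omega), cc_rec α β γ (by omega)]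
    push_cast
    ring
  · rw [if_neg h, if_neg (by omega), if_neg (by omega), if_neg (by omega), if_neg (by omega),
      if_neg (by omega), if_neg (by omega)]
    ring

/-- The transpose of the recursion for `cc`, acting on functions of the index. -/
def ccTranspose (g : ℤ × ℤ × ℤ → ℂ) (x : ℤ × ℤ × ℤ) : ℂ :=
  (2 * x.1 + 4 * x.2.1 + 4 * x.2.2 + 1) / 24 * g (x + (1, 0, 0))
    + (20 * x.2.2 - 4 * x.2.1 - 1) / 24 * g (x + (0, 1, 0))
    + (20 * x.2.1 - 4 * x.2.2 - 1) / 24 * g (x + (0, 0, 1))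
    - 7 * x.1 / 6 * g (x + (-1, 1, 1))
    - x.1 / 12 * g (x + (-1, 2, 0))
    - x.1 / 12 * g (x + (-1, 0, 2))

theorem tsum_ccDegree_succ_mul (k : ℕ) (g : ℤ × ℤ × ℤ → ℂ) :
    ∑' x, ccDegree (k + 1) x * g x = ∑' x, ccDegree k x * ccTranspose g x := by
  have shift := hasSum_ccDegree_sub_mul k
  have h := ((((shift (1, 0, 0) fun x => (2 * x.1 + 4 * x.2.1 + 4 * x.2.2 - 1) / 24 * g x).add
    (shift (0, 1, 0) fun x => (20 * x.2.2 - 4 * x.2.1 + 3) / 24 * g x)).add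
    (shift (0, 0, 1) fun x => (20 * x.2.1 - 4 * x.2.2 + 3) / 24 * g x)).sub
    (shift (-1, 1, 1) fun x => 7 * (x.1 + 1) / 6 * g x)).sub
    (shift (-1, 2, 0) fun x => (x.1 + 1) / 12 * g x) |>.sub
    (shift (-1, 0, 2) fun x => (x.1 + 1) / 12 * g x)
  have s (g : ℤ × ℤ × ℤ → ℂ) := (summable_ccDegree_mul k g).hasSum
  refine ((tsum_congr fun x => ?_).trans h.tsum_eq).trans
    (((((((s _).add (s _)).add (s _)).sub (s _)).sub (s _)).sub (s _)).tsum_eq.symm.trans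
      (tsum_congr fun x => ?_))
  · rw [ccDegree_succ]
    ring
  · simp only [ccTranspose, Prod.fst_add, Prod.snd_add]
    push_cast
    ring

/-- The monomial `P^α a^β b^γ`. Its value is junk at triples with a negative entry. -/
def thetaMonomial (P a b : ℂ) (x : ℤ × ℤ × ℤ) : ℂ :=
  P ^ x.1.toNat * a ^ x.2.1.toNat * b ^ x.2.2.toNat

/-- The value on `P^α a^β b^γ` of the derivation sending `P`, `a`, `b` to
`(P² - a² - 14ab - b²)/12`, `a(P + 5b - a)/6`, `b(P + 5a - b)/6`. With `P = E₂`, `a = θ₂⁴` and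
`b = θ₃⁴` this derivation is `q d/dq`. -/
def thetaMonomialDeriv (P a b : ℂ) (x : ℤ × ℤ × ℤ) : ℂ :=
  (x.1.toNat * P ^ (x.1.toNat - 1) * ((P ^ 2 - a ^ 2 - 14 * (a * b) - b ^ 2) / 12)) *
      (a ^ x.2.1.toNat * b ^ x.2.2.toNat) +
    (x.2.1.toNat * ((P + 5 * b - a) / 6) + x.2.2.toNat * ((P + 5 * a - b) / 6)) *
      thetaMonomial P a b x

theorem ccTranspose_thetaMonomial (P a b : ℂ) {x : ℤ × ℤ × ℤ} (h1 : 0 ≤ x.1) (h2 : 0 ≤ x.2.1)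
    (h3 : 0 ≤ x.2.2) : ccTranspose (thetaMonomial P a b) x =
      thetaMonomialDeriv P a b x + (P - a - b) / 24 * thetaMonomial P a b x := by
  obtain ⟨α, β, γ⟩ := x
  lift α to ℕ using h1
  lift β to ℕ using h2
  lift γ to ℕ using h3
  have toNat_add_one (n : ℕ) : ((n : ℤ) + 1).toNat = n + 1 := by omega
  have toNat_add_two (n : ℕ) : ((n : ℤ) + 2).toNat = n + 2 := by omega
  have toNat_sub_one (n : ℕ) : ((n : ℤ) + -1).toNat = n - 1 := by omega
  simp only [ccTranspose, thetaMonomial, thetaMonomialDeriv, Prod.mk_add_mk, toNat_add_one,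
    toNat_add_two, toNat_sub_one, add_zero, Int.toNat_natCast, Int.cast_natCast]
  rcases α with - | α
  · push_cast
    ring
  · rw [Nat.add_sub_cancel]
    push_cast
    ring

/-- The sum `∑ c_c(α, β, γ) P^α a^β b^γ` over the triples of total degree `k`. -/
def degreeSum (k : ℕ) (P a b : ℂ) : ℂ :=
  ∑ x ∈ degreeSimplex k, ccDegree k x * thetaMonomial P a b x

theorem degreeSum_eq_sum_antidiagonal (k : ℕ) (P a b : ℂ) :
    degreeSum k P a b = ∑ x ∈ antidiagonal k, ∑ y ∈ antidiagonal x.2,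
      (cc x.1 y.1 y.2 : ℂ) * P ^ x.1 * (a ^ y.1 * b ^ y.2) := by
  rw [degreeSum, degreeSimplex, sum_image, sum_sigma]
  · refine sum_congr rfl fun x hx => sum_congr rfl fun y hy => ?_
    rw [HasAntidiagonal.mem_antidiagonal] at hx hy
    rw [ccDegree, if_pos (by dsimp only; omega)]
    simp only [thetaMonomial, Int.toNat_natCast, mul_assoc]
  · rintro ⟨⟨i, j⟩, m, n⟩ hz ⟨⟨i', j'⟩, m', n'⟩ hz' h
    simp only [coe_sigma, Set.mem_sigma_iff, mem_coe, HasAntidiagonal.mem_antidiagonal,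
      Prod.mk.injEq, Nat.cast_inj] at hz hz' h
    obtain ⟨rfl, rfl, rfl⟩ := h
    obtain rfl : j = j' := by omega
    rfl

theorem degreeSum_comm (k : ℕ) (P a b : ℂ) : degreeSum k P a b = degreeSum k P b a := by
  rw [degreeSum, degreeSum, ← tsum_ccDegree_mul, ← tsum_ccDegree_mul,
    ← ((Equiv.refl ℤ).prodCongr (Equiv.prodComm ℤ ℤ)).tsum_eq]
  refine tsum_congr fun x => ?_
  simp only [Equiv.prodCongr_apply, Equiv.coe_refl, Equiv.coe_prodComm, Prod.map, id_eq,
    ccDegree_swap, thetaMonomial, Prod.fst_swap, Prod.snd_swap]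
  ring

theorem degreeSum_zero (P a b : ℂ) : degreeSum 0 P a b = 1 := by
  simp [degreeSum_eq_sum_antidiagonal, cc_zero]

theorem degreeSum_succ (k : ℕ) (P a b : ℂ) : degreeSum (k + 1) P a b =
    (∑ x ∈ degreeSimplex k, ccDegree k x * thetaMonomialDeriv P a b x) +
      (P - a - b) / 24 * degreeSum k P a b := by
  rw [degreeSum, ← tsum_ccDegree_mul, tsum_ccDegree_succ_mul, tsum_ccDegree_mul, degreeSum,
    mul_sum, ← sum_add_distrib]
  refine sum_congr rfl fun x hx => ?_
  obtain ⟨h1, h2, h3, -⟩ := mem_degreeSimplex.1 hx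
  rw [ccTranspose_thetaMonomial P a b h1 h2 h3]
  ring

end Coefficients

section Expansion

variable {q : ℂ}

theorem expansion_eq (k : ℕ) (q : ℂ) :
    expansion k q = 2 * degreeSum k (eisenstein 1 q) (theta2 q ^ 4) (theta3 q ^ 4) := by
  rw [two_mul]
  nth_rw 2 [degreeSum_comm]
  rw [degreeSum_eq_sum_antidiagonal, degreeSum_eq_sum_antidiagonal, ← sum_add_distrib, expansion]
  refine sum_congr rfl fun x _ => ?_
  rw [← sum_add_distrib]
  refine sum_congr rfl fun y _ => ?_
  rw [Theta, pow_mul, pow_mul, pow_mul, pow_mul]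
  ring

theorem hasEulerDerivAt_degreeSum (k : ℕ) (hq : ‖q‖ < 1) :
    HasEulerDerivAt (fun q => degreeSum k (eisenstein 1 q) (theta2 q ^ 4) (theta3 q ^ 4))
      (∑ x ∈ degreeSimplex k,
        ccDegree k x * thetaMonomialDeriv (eisenstein 1 q) (theta2 q ^ 4) (theta3 q ^ 4) x) q := by
  refine HasEulerDerivAt.sum fun x _ => .const_mul _ ?_
  have h2 := (hasEulerDerivAt_theta2_pow_four hq).pow_of_eq_mul_self x.2.1.toNat
  have h3 := (hasEulerDerivAt_theta3_pow_four hq).pow_of_eq_mul_self x.2.2.toNat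
  refine ((((hasEulerDerivAt_eisenstein hq).pow x.1.toNat).mul h2).mul h3).congr_deriv ?_
  rw [four_mul_logD2 hq, four_mul_logD3 hq, thetaMonomialDeriv, thetaMonomial]
  ring

theorem theta4Moment_eq (k : ℕ) (hq : ‖q‖ < 1) : theta4Moment k q =
    theta4 q * degreeSum k (eisenstein 1 q) (theta2 q ^ 4) (theta3 q ^ 4) := by
  induction k generalizing q with
  | zero => rw [degreeSum_zero, theta4Moment_zero, mul_one]
  | succ k ih =>
    have h := (hasEulerDerivAt_theta4Moment k hq).unique
      ((hasEulerDerivAt_theta4 hq).mul (hasEulerDerivAt_degreeSum k hq) |>.congr_of_eventuallyEq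
        ((eventually_norm_lt_one hq).mono fun w hw => ih hw))
    rw [h, degreeSum_succ, eisenstein_eq hq]
    ring

end Expansion

end

end MacMahonC

theorem theorem1p4 (t : ℕ) (ht : 1 ≤ t) (q : ℂ) (hq : ‖q‖ < 1) :
    Summable (MacMahonC.term t q) ∧
    MacMahonC.C t q =
      ∑ k ∈ Finset.Icc 1 t,
        (-1 : ℂ) ^ k * ((MacMahonC.esymmSquares t (t - k) : ℂ) / ((2 * t).factorial : ℂ)) *
          ((1 / 2) * MacMahonC.expansion k q) := by
  refine ⟨MacMahonC.summable_term t hq, mul_right_cancel₀ (MacMahonC.theta4_ne_zero hq) ?_⟩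
  rw [MacMahonC.C_mul_theta4 ht hq, Finset.sum_mul]
  refine Finset.sum_congr rfl fun k _ => ?_
  rw [MacMahonC.theta4Moment_eq k hq, MacMahonC.expansion_eq]
  ring
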